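/- **Setting.** Let $N\in\mathbb N$, and let $W\in L^1_{\mathrm{loc}}(\mathbb R^{dN};\mathbb R)$ with $W\ge 0$ almost everywhere. Let $\omega\ge 0$ be an injective self-adjoint operator on a complex Hilbert space $\mathfrak h$, and let $\mathfrak h_\omega$ be the Hilbert completion of $\bigcap_{k}\mathscr D(\omega^k)$ for the scalar product $\langle\,\cdot\,|\omega|\,\cdot\,\rangle$; $\omega^{1/2}$ extends to an isometry $\mathfrak h_\omega\to\mathfrak h$, and for $\lambda\in\mathscr D(\omega^{-1/2})$, $z\in\mathfrak h_\omega$ we write $\langle z|\lambda\rangle:=\langle\omega^{1/2}z|\omega^{-1/2}\lambda\rangle$ and $\langle z|\omega|z\rangle:=\|z\|^2_{\mathfrak h_\omega}$. Put $\mathscr H=L^2(\mathbb R^{dN})$. Consider one of the following three families of Hamiltonians $\mathcal H_z$, $z\in\mathfrak h_\omega$, understood as quadratic forms on the form domain $\mathscr Q(\mathcal K_0)=\{\psi\in H^1(\mathbb R^{dN}):\int W|\psi|^2<\infty\}$ of the free operator $\mathcal K_0$. * *Nelson model*, $d\in\{1,2,3\}$, $\lambda,\omega^{-1/2}\lambda\in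 L^\infty(\mathbb R^d;\mathfrak h)$: $\mathcal K_0=\sum_j(-\Delta_j)+W$ and $\mathcal H_z=\mathcal K_0+\sum_{j=1}^N 2\,\mathrm{Re}\langle z|\lambda(x_j)\rangle+\langle z|\omega|z\rangle$. * *Polaron*, $d\in\{1,2,3\}$, $\alpha>0$, $\mathfrak h=\mathfrak h_\omega=L^2(\mathbb R^d)$, $\omega=1$: $\mathcal K_0=\sum_j(-\Delta_j)+W$ and $\mathcal H_z=\mathcal K_0+\sum_{j=1}^N 2\,\mathrm{Re}\langle z|\lambda(x_j)\rangle+\|z\|^2$ with $\lambda(x;k)=\sqrt\alpha\,e^{-ik\cdot x}|k|^{-(d-1)/2}$. Here, for an arbitrary $\varrho>0$, the potential is understood as the form of $\sqrt\alpha\,(V_<+\nabla\cdot V_>)$ with the bounded functions $$V_<(x)=2\,\mathrm{Re}\int_{|k|\le\varrho}\frac{\overline{z(k)}e^{-ik\cdot x}}{|k|^{(d-1)/2}}\,dk,\qquad V_>(x)=-2\,\mathrm{Im}\int_{|k|>\varrho}\frac{\overline{z(k)}e^{-ik\cdot x}}{|k|^{(d+1)/2}}\frac{k}{|k|}\,dk,$$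 where $\langle\psi|(\nabla_j\cdot V_>)(x_j)|\psi\rangle:=-2\,\mathrm{Re}\int V_>(x_j)\cdot\overline\psi\,\nabla_j\psi$. * *Pauli–Fierz model*, $d=3$, $m_j>0$, $e\in\mathbb R$, $\lambda_{j,\ell},\omega^{\pm1/2}\lambda_{j,\ell}\in L^\infty(\mathbb R^3;\mathfrak h)$ for $1\le j\le N$, $1\le\ell\le 3$, and $\sum_\ell\partial_\ell\lambda_{j,\ell}=0$ in the sense of distributions: $\mathcal K_0=\sum_j\frac1{2m_j}(-\Delta_j)+W$ and $\mathcal H_z=\sum_{j=1}^N\frac1{2m_j}\bigl(-i\nabla_j+e\,a_{z,j}(x_j)\bigr)^2+W+\langle z|\omega|z\rangle$ with $(a_{z,j})_\ell(x)=2\,\mathrm{Re}\langle z|\lambda_{j,\ell}(x)\rangle$. **Quasi-classical energy.** $$E_{\mathrm{qc}}=\inf\bigl\{\langle\psi|\mathcal H_z|\psi\rangle:\ \psi\in\mathscr Q(\mathcal K_0),\ \|\psi\|=1,\ z\in\mathfrak h_\omega\bigr\}.$$ **Generalized states.** Let $\overline{\mathscr L}{}^1_+$ be the set of positive functionals in the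 weak-$*$ closure, in the dual of the bounded operators $\mathscr B(\mathscr H)$, of the trace class operators (acting by $B\mapsto\mathrm{tr}(\gamma B)$), and let $\overline{\mathscr L}{}^1_{+,1}$ be the subset of those of norm one; the pure generalized states are the extreme points of $\overline{\mathscr L}{}^1_{+,1}$. Let $\mathcal T=\mathcal K_0+1$. A state $\rho\in\overline{\mathscr L}{}^1_{+,1}$ is in the domain of $\mathcal T$ if there is $\rho_{\mathcal T}\in\overline{\mathscr L}{}^1_{+}$ with $\rho_{\mathcal T}[\mathcal T^{-1/2}B\mathcal T^{-1/2}]=\rho[B]$ for every $B\in\mathscr B(\mathscr H)$; then $\rho[\mathcal H_z]:=\rho_{\mathcal T}[\mathcal T^{-1/2}\mathcal H_z\mathcal T^{-1/2}]$, where $\mathcal T^{-1/2}\mathcal H_z\mathcal T^{-1/2}$ is the bounded operator with quadratic form $\varphi\mapsto\langle\mathcal T^{-1/2}\varphi|\mathcal H_z|\mathcal T^{-1/2}\varphi\rangle$. Let $$E_{\mathrm{gqc}}=\inf\bigl\{\rho[\mathcal H_z]:\ \rho\in\overline{\mathscr L}{}^1_{+,1}\text{ in the domain of }\mathcal T,\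 z\in\mathfrak h_\omega\bigr\},$$ the infimum being also over all admissible $\rho_{\mathcal T}$. **Generalized state-valued measures.** A generalized state-valued measure on $\mathfrak h_\omega$ is a map $\mathfrak n$ from the Borel sets of $\mathfrak h_\omega$ to $\overline{\mathscr L}{}^1_+$ that is countably additive for the dual norm; it is a probability measure if $\|\mathfrak n(\mathfrak h_\omega)\|=1$. It is in the domain of $\mathcal T$ if there is a generalized state-valued measure $\mathfrak n_{\mathcal T}$ with $\mathfrak n_{\mathcal T}(S)[\mathcal T^{-1/2}B\mathcal T^{-1/2}]=\mathfrak n(S)[B]$ for all Borel $S$ and all $B\in\mathscr B(\mathscr H)$. Let $$E_{\mathrm{gsvm}}=\inf\int_{\mathfrak h_\omega}d\mathfrak n_{\mathcal T}(z)\bigl[\mathcal T^{-1/2}\mathcal H_z\mathcal T^{-1/2}\bigr],$$ the infimum being over the generalized state-valued probability measures $\mathfrak n$ in the domain of $\mathcal T$ and the admissible $\mathfrak n_{\mathcal T}$ for which $z\mapsto\mathcal T^{-1/2}\mathcal H_z\mathcal T^{-1/2}$ is absolutely (Bochner) integrable with respect to the norm measure $S\mapsto\|\mathfrak n_{\mathcal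 T}(S)\|$. **Proposition (generalized quasi-classical ground state energy).** For each of the three models, as elements of $[-\infty,\infty]$, $$E_{\mathrm{qc}}=E_{\mathrm{gqc}}=E_{\mathrm{gsvm}},$$ and the value of $E_{\mathrm{gqc}}$ does not change if only pure generalized states are admitted. -/

import Mathlib

open MeasureTheory Filter Topology
open scoped ComplexOrder InnerProductSpace ComplexConjugate

noncomputable section

/-! ## Generalized states on the bounded operators of a Hilbert space -/

section GeneralizedStates

variable {H : Type*} [NormedAddCommGroup H] [InnerProductSpace ℂ H] [CompleteSpace H]

/-- The functionals `B ↦ tr (γ B)` with `γ` trace class, written through the nuclear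
representation `γ = ∑ₙ |vₙ⟩⟨uₙ|`, `∑ₙ ‖uₙ‖ ‖vₙ‖ < ∞`, of trace class operators. -/
def traceClassFunctionals (H : Type*) [NormedAddCommGroup H] [InnerProductSpace ℂ H] :
    Set (StrongDual ℂ (H →L[ℂ] H)) :=
  {F | ∃ u v : ℕ → H, Summable (fun n => ‖u n‖ * ‖v n‖) ∧
    ∀ B : H →L[ℂ] H, HasSum (fun n => inner ℂ (u n) (B (v n))) (F B)}

/-- Positive functionals in the weak-* closure of the trace class operators. -/
def generalizedStateCone (H : Type*) [NormedAddCommGroup H] [InnerProductSpace ℂ H] :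
    Set (StrongDual ℂ (H →L[ℂ] H)) :=
  {F | StrongDual.toWeakDual F ∈ closure (StrongDual.toWeakDual '' traceClassFunctionals H) ∧
    ∀ B : H →L[ℂ] H, B.IsPositive → 0 ≤ F B}

/-- Normalized generalized states. -/
def generalizedStates (H : Type*) [NormedAddCommGroup H] [InnerProductSpace ℂ H] :
    Set (StrongDual ℂ (H →L[ℂ] H)) :=
  {F | F ∈ generalizedStateCone H ∧ ‖F‖ = 1}

/-- Pure generalized states: the extreme points of the convex set of normalized ones. -/
def pureGeneralizedStates (H : Type*) [NormedAddCommGroup H] [InnerProductSpace ℂ H] :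
    Set (StrongDual ℂ (H →L[ℂ] H)) :=
  (generalizedStates H).extremePoints ℝ

/-- A generalized state-valued measure: a vector measure, countably additive for the dual norm,
with values in the cone of positive generalized states. -/
def IsGeneralizedStateMeasure {Z : Type*} [MeasurableSpace Z]
    (n : VectorMeasure Z (StrongDual ℂ (H →L[ℂ] H))) : Prop :=
  ∀ S, MeasurableSet S → n S ∈ generalizedStateCone H

/-- The evaluation pairing `(B, F) ↦ F B`. -/
def evalPairing (H : Type*) [NormedAddCommGroup H] [InnerProductSpace ℂ H] :
    (H →L[ℂ] H) →L[ℝ] StrongDual ℂ (H →L[ℂ] H) →L[ℝ] ℂ :=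
  LinearMap.mkContinuous₂
    (LinearMap.mk₂ ℝ (fun (B : H →L[ℂ] H) (F : StrongDual ℂ (H →L[ℂ] H)) => F B)
      (fun _ _ _ => map_add _ _ _)
      (fun c B F => by
        rw [RCLike.real_smul_eq_coe_smul (K := ℂ) c B, map_smul]
        exact (RCLike.real_smul_eq_coe_smul (K := ℂ) c (F B)).symm)
      (fun _ _ _ => rfl) (fun _ _ _ => rfl))
    1 (fun B F => by
      rw [one_mul, mul_comm]
      exact F.le_opNorm B)

end GeneralizedStates

/-! ## The three variational problems -/

/-- The quadratic forms of a particle system coupled to a classical field `z ∈ Z`: the common form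
domain `𝒬(𝒦₀) = 𝒬(ℋ_z)`, the form `ψ ↦ ⟨ψ|𝒦₀|ψ⟩` of the free particle Hamiltonian, and the form
`ψ ↦ ⟨ψ|ℋ_z|ψ⟩` of the quasi-classical Hamiltonian; only the values on the form domain matter. -/
structure QuasiClassicalForms (H Z : Type*) where
  formDomain : Set H
  freeForm : H → ℝ
  energyForm : Z → H → ℝ

namespace QuasiClassicalForms

variable {H Z : Type*} [NormedAddCommGroup H] [InnerProductSpace ℂ H] [CompleteSpace H]
  [MeasurableSpace Z] (M : QuasiClassicalForms H Z)

/-- `E_qc`: the infimum of `⟨ψ|ℋ_z|ψ⟩` over normalized `ψ` of finite energy and over `z`. -/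
def energyQC : EReal :=
  sInf {E | ∃ (ψ : H) (z : Z), ‖ψ‖ = 1 ∧ ψ ∈ M.formDomain ∧ E = ((M.energyForm z ψ : ℝ) : EReal)}

/-- `R = 𝒯^{-1/2}` for `𝒯 = 𝒦₀ + 1`: the positive bounded operator whose range is
`𝒟(𝒯^{1/2}) = 𝒬(𝒦₀)` and for which `‖𝒯^{1/2} ψ‖² = ⟨ψ|𝒦₀ + 1|ψ⟩` at `ψ = R φ`. -/
def IsInvSqrt (R : H →L[ℂ] H) : Prop :=
  R.IsPositive ∧ Set.range R = M.formDomain ∧ ∀ φ, M.freeForm (R φ) + ‖R φ‖ ^ 2 = ‖φ‖ ^ 2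

/-- `G` is the bounded operator `𝒯^{-1/2} ℋ_z 𝒯^{-1/2}`, where `R = 𝒯^{-1/2}`. -/
def IsSandwich (R : H →L[ℂ] H) (z : Z) (G : H →L[ℂ] H) : Prop :=
  ∀ φ, inner ℂ φ (G φ) = ((M.energyForm z (R φ) : ℝ) : ℂ)

/-- The generalized state `ρ` is in the domain of `𝒯 = 𝒦₀ + 1`, and `ρ[ℋ_z] = E`: there is a
positive generalized state `ρ_𝒯` with `ρ_𝒯[𝒯^{-1/2} B 𝒯^{-1/2}] = ρ[B]` for all bounded `B`, and
`ρ[ℋ_z] = ρ_𝒯[𝒯^{-1/2} ℋ_z 𝒯^{-1/2}]`. -/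
def HasGeneralizedEnergy (ρ : StrongDual ℂ (H →L[ℂ] H)) (z : Z) (E : ℝ) : Prop :=
  ∃ (R G : H →L[ℂ] H) (ρT : StrongDual ℂ (H →L[ℂ] H)),
    M.IsInvSqrt R ∧ M.IsSandwich R z G ∧ ρT ∈ generalizedStateCone H ∧
    (∀ B : H →L[ℂ] H, ρT (R ∘L B ∘L R) = ρ B) ∧ ρT G = (E : ℂ)

/-- `E_gqc`: the infimum of `ρ[ℋ_z]` over normalized generalized states `ρ` and over `z`. -/
def energyGQC : EReal :=
  sInf {E | ∃ (ρ : StrongDual ℂ (H →L[ℂ] H)) (z : Z) (e : ℝ),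
    ρ ∈ generalizedStates H ∧ M.HasGeneralizedEnergy ρ z e ∧ E = (e : EReal)}

/-- The variant of `E_gqc` in which only pure generalized states are admitted. -/
def energyGQCPure : EReal :=
  sInf {E | ∃ (ρ : StrongDual ℂ (H →L[ℂ] H)) (z : Z) (e : ℝ),
    ρ ∈ pureGeneralizedStates H ∧ M.HasGeneralizedEnergy ρ z e ∧ E = (e : EReal)}

/-- The generalized state-valued measure `n` is in the domain of `𝒯 = 𝒦₀ + 1`, the function
`z ↦ 𝒯^{-1/2} ℋ_z 𝒯^{-1/2}` is absolutely integrable with respect to `n_𝒯`, and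
`∫ dn(z)[ℋ_z] = ∫ dn_𝒯(z)[𝒯^{-1/2} ℋ_z 𝒯^{-1/2}] = E`. For measures with values in positive
functionals the variation is the norm measure `S ↦ ‖n_𝒯(S)‖`. -/
def HasGeneralizedMeasureEnergy (n : VectorMeasure Z (StrongDual ℂ (H →L[ℂ] H))) (E : ℝ) : Prop :=
  ∃ (R : H →L[ℂ] H) (G : Z → H →L[ℂ] H) (nT : VectorMeasure Z (StrongDual ℂ (H →L[ℂ] H))),
    M.IsInvSqrt R ∧ (∀ z, M.IsSandwich R z (G z)) ∧ IsGeneralizedStateMeasure nT ∧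
    (∀ S, MeasurableSet S → ∀ B : H →L[ℂ] H, nT S (R ∘L B ∘L R) = n S B) ∧
    nT.Integrable G ∧ nT.integral G (evalPairing H) = (E : ℂ)

/-- `E_gsvm`: the infimum of `∫ dn(z)[ℋ_z]` over generalized state-valued probability measures. -/
def energyGSVM : EReal :=
  sInf {E | ∃ (n : VectorMeasure Z (StrongDual ℂ (H →L[ℂ] H))) (e : ℝ),
    IsGeneralizedStateMeasure n ∧ ‖n Set.univ‖ = 1 ∧
    M.HasGeneralizedMeasureEnergy n e ∧ E = (e : EReal)}

end QuasiClassicalForms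

/-! ## The particle system -/

/-- Configurations `X = (x₁, …, x_N)` of `N` particles in `ℝᵈ`. -/
abbrev Config (N d : ℕ) : Type := Fin N → EuclideanSpace ℝ (Fin d)

/-- `L²(ℝ^{dN})`. -/
abbrev ParticleSpace (N d : ℕ) : Type := Lp ℂ 2 (volume : Measure (Config N d))

/-- The unit vector of `ℝ^{dN}` for the `l`-th coordinate of the `j`-th particle. -/
def coordVec {N d : ℕ} (j : Fin N) (l : Fin d) : Config N d :=
  Pi.single j (EuclideanSpace.single l (1 : ℝ))

/-- `g` is the weak partial derivative `∂_{j,l} ψ`. -/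
def HasWeakPartial {N d : ℕ} (ψ : ParticleSpace N d) (j : Fin N) (l : Fin d)
    (g : ParticleSpace N d) : Prop :=
  ∀ φ : Config N d → ℝ, ContDiff ℝ (⊤ : ℕ∞) φ → HasCompactSupport φ →
    ∫ X, (fderiv ℝ φ X (coordVec j l)) • ψ X = -∫ X, φ X • g X

open Classical in
/-- The weak partial derivative `∂_{j,l} ψ` (zero if there is none in `L²`). -/
def weakPartial {N d : ℕ} (ψ : ParticleSpace N d) (j : Fin N) (l : Fin d) : ParticleSpace N d :=
  if h : ∃ g, HasWeakPartial ψ j l g then h.choose else 0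

/-- The form domain of `-Δ + W`: all `ψ ∈ H¹(ℝ^{dN})` with `∫ W |ψ|² < ∞`. -/
def freeFormDomain {N d : ℕ} (W : Config N d → ℝ) : Set (ParticleSpace N d) :=
  {ψ | (∀ j l, ∃ g, HasWeakPartial ψ j l g) ∧ Integrable (fun X => W X * ‖ψ X‖ ^ 2)}

/-- The form of `𝒦₀ = ∑ⱼ cⱼ (-Δⱼ) + W`. -/
def freeFormOf {N d : ℕ} (c : Fin N → ℝ) (W : Config N d → ℝ) (ψ : ParticleSpace N d) : ℝ :=
  (∑ j, c j * ∑ l, ‖weakPartial ψ j l‖ ^ 2) + ∫ X, W X * ‖ψ X‖ ^ 2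

/-! ## The field and its phase space `𝔥_ω` -/

/-- A nonnegative self-adjoint, possibly unbounded, operator. -/
def IsNonnegSelfAdjoint {h : Type*} [NormedAddCommGroup h] [InnerProductSpace ℂ h]
    [CompleteSpace h] (A : h →ₗ.[ℂ] h) : Prop :=
  IsSelfAdjoint A ∧ ∀ x : A.domain, 0 ≤ (inner ℂ (x : h) (A x)).re

/-- The one-excitation energy: an injective nonnegative self-adjoint operator `ω`, together with
its (unique) nonnegative self-adjoint square root `ω^{1/2}`. -/
structure Dispersion (h : Type*) [NormedAddCommGroup h] [InnerProductSpace ℂ h]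
    [CompleteSpace h] where
  op : h →ₗ.[ℂ] h
  sqrt : h →ₗ.[ℂ] h
  op_nonneg : IsNonnegSelfAdjoint op
  op_injective : ∀ x : op.domain, op x = 0 → (x : h) = 0
  sqrt_nonneg : IsNonnegSelfAdjoint sqrt
  mem_op_domain_iff : ∀ x : h,
    x ∈ op.domain ↔ ∃ hx : x ∈ sqrt.domain, sqrt ⟨x, hx⟩ ∈ sqrt.domain
  op_eq : ∀ (x : op.domain) (hx : (x : h) ∈ sqrt.domain) (hx' : sqrt ⟨x, hx⟩ ∈ sqrt.domain),
    op x = sqrt ⟨sqrt ⟨x, hx⟩, hx'⟩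

namespace Dispersion

variable {h : Type*} [NormedAddCommGroup h] [InnerProductSpace ℂ h] [CompleteSpace h]
  (ω : Dispersion h)

/-- The domain of `ω ^ k`. -/
def powDomain : ℕ → Submodule ℂ h
  | 0 => ⊤
  | k + 1 => ((powDomain k).comap ω.op.toFun).map ω.op.domain.subtype

/-- The space `⋂ₖ 𝒟(ω ^ k)`. -/
def SmoothVec : Type _ := ↥(⨅ k, ω.powDomain k)

instance : AddCommGroup ω.SmoothVec := inferInstanceAs (AddCommGroup ↥(⨅ k, ω.powDomain k))

instance : Module ℂ ω.SmoothVec := inferInstanceAs (Module ℂ ↥(⨅ k, ω.powDomain k))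

/-- The inclusion of `⋂ₖ 𝒟(ω ^ k)` in `𝔥`. -/
def smoothIncl : ω.SmoothVec →ₗ[ℂ] h := (⨅ k, ω.powDomain k).subtype

theorem smoothIncl_mem (x : ω.SmoothVec) : ω.smoothIncl x ∈ ω.op.domain := by
  have hx : ω.smoothIncl x ∈ ω.powDomain 1 :=
    (Submodule.mem_iInf _).1 (show ω.smoothIncl x ∈ ⨅ k, ω.powDomain k from x.2) 1
  obtain ⟨y, -, hy⟩ := hx
  rw [← hy]
  exact y.2

theorem smoothIncl_mem_sqrt (x : ω.SmoothVec) : ω.smoothIncl x ∈ ω.sqrt.domain :=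
  ((ω.mem_op_domain_iff _).1 (ω.smoothIncl_mem x)).1

/-- `ω` on `⋂ₖ 𝒟(ω ^ k)`. -/
def smoothOp : ω.SmoothVec →ₗ[ℂ] h :=
  ω.op.toFun ∘ₗ ω.smoothIncl.codRestrict ω.op.domain ω.smoothIncl_mem

/-- `ω^{1/2}` on `⋂ₖ 𝒟(ω ^ k)`. -/
def smoothSqrt : ω.SmoothVec →ₗ[ℂ] h :=
  ω.sqrt.toFun ∘ₗ ω.smoothIncl.codRestrict ω.sqrt.domain ω.smoothIncl_mem_sqrt

theorem inner_smoothOp (x y : ω.SmoothVec) :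
    inner ℂ (ω.smoothIncl x) (ω.smoothOp y) = inner ℂ (ω.smoothSqrt x) (ω.smoothSqrt y) := by
  obtain ⟨hy, hy'⟩ := (ω.mem_op_domain_iff _).1 (ω.smoothIncl_mem y)
  have h1 : ω.smoothOp y = ω.sqrt ⟨ω.smoothSqrt y, hy'⟩ :=
    ω.op_eq ⟨ω.smoothIncl y, ω.smoothIncl_mem y⟩ hy hy'
  have hs := ω.sqrt_nonneg.1
  have hf := LinearPMap.adjoint_isFormalAdjoint hs.dense_domain
  rw [LinearPMap.isSelfAdjoint_def.1 hs] at hf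
  rw [h1]
  exact (hf ⟨ω.smoothIncl x, ω.smoothIncl_mem_sqrt x⟩ ⟨ω.smoothSqrt y, hy'⟩).symm

/-- The scalar product `⟨x|ω|y⟩` on `⋂ₖ 𝒟(ω ^ k)`. -/
instance smoothCore : PreInnerProductSpace.Core ℂ ω.SmoothVec where
  inner x y := inner ℂ (ω.smoothIncl x) (ω.smoothOp y)
  conj_inner_symm x y := by simp only [inner_smoothOp, inner_conj_symm]
  re_inner_nonneg x := by simp only [inner_smoothOp]; exact inner_self_nonneg
  add_left x y z := by simp only [map_add, inner_add_left]
  smul_left x y r := by simp only [map_smul, inner_smul_left]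

instance : SeminormedAddCommGroup ω.SmoothVec :=
  InnerProductSpace.Core.toSeminormedAddCommGroup (𝕜 := ℂ)

instance : InnerProductSpace ℂ ω.SmoothVec := InnerProductSpace.ofCore ω.smoothCore

/-- The phase space `𝔥_ω`: the Hilbert completion of `⋂ₖ 𝒟(ω ^ k)` for `⟨·|ω|·⟩`. -/
abbrev PhaseSpace : Type _ := UniformSpace.Completion ω.SmoothVec

instance : MeasurableSpace ω.PhaseSpace := borel _

theorem norm_smoothSqrt (x : ω.SmoothVec) : ‖ω.smoothSqrt x‖ = ‖x‖ := by
  have h1 : ‖ω.smoothSqrt x‖ ^ 2 = ‖x‖ ^ 2 := by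
    rw [← inner_self_eq_norm_sq (𝕜 := ℂ), ← inner_self_eq_norm_sq (𝕜 := ℂ), ← inner_smoothOp]
    rfl
  exact (sq_eq_sq₀ (norm_nonneg _) (norm_nonneg _)).1 h1

/-- The continuous extension of `ω^{1/2}` to `𝔥_ω`, with values in `𝔥`. -/
def sqrtExt : ω.PhaseSpace →L[ℂ] h :=
  (ω.smoothSqrt.mkContinuous 1 fun x => by rw [one_mul, norm_smoothSqrt]).extend
    (UniformSpace.Completion.toComplL : ω.SmoothVec →L[ℂ] ω.PhaseSpace)

/-- `ξ = ω^{-1/2} λ`. -/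
def IsInvSqrtOf (ξ lam : h) : Prop := ∃ hξ : ξ ∈ ω.sqrt.domain, ω.sqrt ⟨ξ, hξ⟩ = lam

end Dispersion

/-! ## The Nelson model -/

/-- A form factor `λ` with `λ, ω^{-1/2} λ ∈ L^∞(ℝᵈ; 𝔥)`. -/
structure NelsonFormFactor {h : Type*} [NormedAddCommGroup h] [InnerProductSpace ℂ h]
    [CompleteSpace h] (ω : Dispersion h) (d : ℕ) where
  lam : EuclideanSpace ℝ (Fin d) → h
  xi : EuclideanSpace ℝ (Fin d) → h
  memLp_lam : MemLp lam ⊤ volume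
  memLp_xi : MemLp xi ⊤ volume
  xi_eq : ∀ᵐ x, ω.IsInvSqrtOf (xi x) (lam x)

section Nelson

variable {h : Type*} [NormedAddCommGroup h] [InnerProductSpace ℂ h] [CompleteSpace h]
  {ω : Dispersion h} {d : ℕ}

/-- `𝒱_z(x) = 2 Re ⟨z|λ(x)⟩ = 2 Re ⟨ω^{1/2} z|ω^{-1/2} λ(x)⟩`, for `z ∈ 𝔥_ω`. -/
def nelsonPotential (F : NelsonFormFactor ω d) (z : ω.PhaseSpace)
    (x : EuclideanSpace ℝ (Fin d)) : ℝ :=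
  2 * (inner ℂ (ω.sqrtExt z) (F.xi x)).re

/-- `ℋ_z = ∑ⱼ (-Δⱼ + 𝒱_z(xⱼ)) + W + ⟨z|ω|z⟩`. -/
def nelsonModel {N : ℕ} (W : Config N d → ℝ) (F : NelsonFormFactor ω d) :
    QuasiClassicalForms (ParticleSpace N d) ω.PhaseSpace where
  formDomain := freeFormDomain W
  freeForm := freeFormOf (fun _ => 1) W
  energyForm z ψ := freeFormOf (fun _ => 1) W ψ
    + (∑ j, ∫ X, nelsonPotential F z (X j) * ‖ψ X‖ ^ 2) + ‖z‖ ^ 2 * ‖ψ‖ ^ 2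

end Nelson

/-! ## The polaron -/

/-- The phase space of the polaron: `𝔥_ω = 𝔥 = L²(ℝᵈ)`, since `ω = 1`. -/
abbrev PolaronField (d : ℕ) : Type := Lp ℂ 2 (volume : Measure (EuclideanSpace ℝ (Fin d)))

instance (d : ℕ) : MeasurableSpace (PolaronField d) := borel _

/-- The bounded function `2 Re ∫_{|k| ≤ ϱ} z̄(k) e^{-ik·x} |k|^{-(d-1)/2} dk`. -/
def polaronLow {d : ℕ} (r : ℝ) (z : PolaronField d) (x : EuclideanSpace ℝ (Fin d)) : ℝ :=
  2 * (∫ k in {k : EuclideanSpace ℝ (Fin d) | ‖k‖ ≤ r},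
    conj (z k) * Complex.exp (-Complex.I * ((inner ℝ k x : ℝ) : ℂ))
      * ((‖k‖ ^ (-((d : ℝ) - 1) / 2) : ℝ) : ℂ)).re

/-- The components of the bounded vector field
`-2 Im ∫_{|k| > ϱ} z̄(k) e^{-ik·x} |k|^{-(d+1)/2} (k / |k|) dk`; its divergence is
`2 Re ∫_{|k| > ϱ} z̄(k) e^{-ik·x} |k|^{-(d-1)/2} dk`. -/
def polaronHigh {d : ℕ} (r : ℝ) (z : PolaronField d) (l : Fin d)
    (x : EuclideanSpace ℝ (Fin d)) : ℝ :=
  -2 * (∫ k in {k : EuclideanSpace ℝ (Fin d) | r < ‖k‖},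
    conj (z k) * Complex.exp (-Complex.I * ((inner ℝ k x : ℝ) : ℂ))
      * ((‖k‖ ^ (-((d : ℝ) + 1) / 2) * (k l / ‖k‖) : ℝ) : ℂ)).im

/-- The form of the polaron Hamiltonian `∑ⱼ (-Δⱼ + 𝒱_z(xⱼ)) + W + ‖z‖²` with
`𝒱_z(x) = 2 Re ⟨z|λ(x)⟩`, `λ(x; k) = √α e^{-ik·x} |k|^{-(d-1)/2}`, where
`𝒱_z = √α (V_< + ∇·V_>)` is split at `|k| = ϱ` and the divergence is moved to `|ψ|²` by parts:
`⟨ψ|(∇ⱼ·V_>)(xⱼ)|ψ⟩ = -2 Re ∫ V_>(xⱼ)·ψ̄ ∇ⱼψ`. -/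
def polaronModel {N d : ℕ} (W : Config N d → ℝ) (α r : ℝ) :
    QuasiClassicalForms (ParticleSpace N d) (PolaronField d) where
  formDomain := freeFormDomain W
  freeForm := freeFormOf (fun _ => 1) W
  energyForm z ψ := freeFormOf (fun _ => 1) W ψ
    + √α * (∑ j, ((∫ X, polaronLow r z (X j) * ‖ψ X‖ ^ 2)
      - 2 * ∑ l, ∫ X, polaronHigh r z l (X j) * (conj (ψ X) * weakPartial ψ j l X).re))
    + ‖z‖ ^ 2 * ‖ψ‖ ^ 2

/-! ## The Pauli-Fierz model -/

/-- Form factors `λ_{j,l}` with `λ_{j,l}, ω^{±1/2} λ_{j,l} ∈ L^∞(ℝ³; 𝔥)` in the Coulomb gauge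
`∇ⱼ·λⱼ = 0` (in the sense of distributions). -/
structure PauliFierzFormFactor {h : Type*} [NormedAddCommGroup h] [InnerProductSpace ℂ h]
    [CompleteSpace h] (ω : Dispersion h) (N : ℕ) where
  lam : Fin N → Fin 3 → EuclideanSpace ℝ (Fin 3) → h
  xi : Fin N → Fin 3 → EuclideanSpace ℝ (Fin 3) → h
  zeta : Fin N → Fin 3 → EuclideanSpace ℝ (Fin 3) → h
  memLp_lam : ∀ j l, MemLp (lam j l) ⊤ volume
  memLp_xi : ∀ j l, MemLp (xi j l) ⊤ volume
  memLp_zeta : ∀ j l, MemLp (zeta j l) ⊤ volume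
  xi_eq : ∀ j l, ∀ᵐ x, ω.IsInvSqrtOf (xi j l x) (lam j l x)
  zeta_eq : ∀ j l, ∀ᵐ x, ω.IsInvSqrtOf (lam j l x) (zeta j l x)
  coulomb : ∀ j, ∀ φ : EuclideanSpace ℝ (Fin 3) → ℝ, ContDiff ℝ (⊤ : ℕ∞) φ → HasCompactSupport φ →
    ∑ l, ∫ x, (fderiv ℝ φ x (EuclideanSpace.single l 1)) • lam j l x = 0

section PauliFierz

variable {h : Type*} [NormedAddCommGroup h] [InnerProductSpace ℂ h] [CompleteSpace h]
  {ω : Dispersion h} {N : ℕ}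

/-- The `l`-th component of the classical field `a_{z,j}(x) = 2 Re ⟨z|λⱼ(x)⟩`. -/
def pauliFierzField (F : PauliFierzFormFactor ω N) (z : ω.PhaseSpace) (j : Fin N) (l : Fin 3)
    (x : EuclideanSpace ℝ (Fin 3)) : ℝ :=
  2 * (inner ℂ (ω.sqrtExt z) (F.xi j l x)).re

/-- `ℋ_z = ∑ⱼ (2mⱼ)⁻¹ (-i∇ⱼ + e a_{z,j}(xⱼ))² + W + ⟨z|ω|z⟩`. -/
def pauliFierzModel (W : Config N 3 → ℝ) (mass : Fin N → ℝ) (e : ℝ)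
    (F : PauliFierzFormFactor ω N) : QuasiClassicalForms (ParticleSpace N 3) ω.PhaseSpace where
  formDomain := freeFormDomain W
  freeForm := freeFormOf (fun j => 1 / (2 * mass j)) W
  energyForm z ψ := (∑ j, 1 / (2 * mass j) * ∑ l, ∫ X,
      ‖-Complex.I * weakPartial ψ j l X + ((e * pauliFierzField F z j l (X j) : ℝ) : ℂ) * ψ X‖ ^ 2)
    + (∫ X, W X * ‖ψ X‖ ^ 2) + ‖z‖ ^ 2 * ‖ψ‖ ^ 2

end PauliFierz

end

/-!
The lower bounds rest on positivity. If `E ≤ E_qc`, then `E 𝒯⁻¹ ≤ 𝒯^{-1/2} ℋ_z 𝒯^{-1/2}` for every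
`z`, since every vector of the form domain can be normalized. Positive functionals, and integrals
against measures with values in them, preserve this inequality, and
`ρ_𝒯[𝒯⁻¹] = ρ[1] = ‖ρ‖ = 1` turns its left side into `E`. The upper bounds come from vector states
`ψ = 𝒯^{-1/2} φ`, with `ρ_𝒯` the vector functional of `φ`, and from Dirac measures; a vector state
is pure because the rank one projection onto its vector exposes it.

For the models, `𝒯^{-1/2}` is the positive factor in the polar decomposition of the inclusion into
`L²` of the form space, that is, of the joint graph of `√W` and the `√cⱼ ∂_{j,l}`. Composed with
`𝒯^{-1/2}` these operators become bounded, and the interactions involve only bounded functions.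
-/

section PositiveFunctionals

variable {A : Type*} [CStarAlgebra A] [PartialOrder A] [StarOrderedRing A] {F : StrongDual ℂ A}

theorem norm_apply_star_mul_sq_le (hF : ∀ a, 0 ≤ a → 0 ≤ F a) (a b : A) :
    ‖F (star a * b)‖ ^ 2 ≤ ‖F (star a * a)‖ * ‖F (star b * b)‖ := by
  let f : A →ₚ[ℂ] ℂ := PositiveLinearMap.mk₀ F.toLinearMap hF
  have norm_sq : ∀ c, ‖f.toPreGNS c‖ ^ 2 = ‖F (star c * c)‖ := fun c => by
    have := congrArg norm (f.preGNS_norm_sq (f.toPreGNS c))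
    rwa [norm_pow, Complex.norm_real, norm_norm] at this
  calc ‖F (star a * b)‖ ^ 2 ≤ (‖f.toPreGNS a‖ * ‖f.toPreGNS b‖) ^ 2 := by
        gcongr
        exact norm_inner_le_norm (𝕜 := ℂ) (f.toPreGNS a) (f.toPreGNS b)
    _ = ‖F (star a * a)‖ * ‖F (star b * b)‖ := by rw [mul_pow, norm_sq, norm_sq]

theorem norm_apply_le_norm_apply_one_mul (hF : ∀ a, 0 ≤ a → 0 ≤ F a) (a : A) :
    ‖F a‖ ≤ ‖F 1‖ * ‖a‖ := by
  have cauchy_schwarz := norm_apply_star_mul_sq_le hF 1 a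
  rw [star_one, one_mul, one_mul] at cauchy_schwarz
  have bound : ‖F (star a * a)‖ ≤ ‖F 1‖ * ‖star a * a‖ :=
    (PositiveLinearMap.mk₀ F.toLinearMap hF).norm_apply_le_of_nonneg _ (star_mul_self_nonneg a)
  refine le_of_sq_le_sq ?_ (by positivity)
  calc ‖F a‖ ^ 2 ≤ ‖F 1‖ * (‖F 1‖ * ‖star a * a‖) := cauchy_schwarz.trans (by gcongr)
    _ = (‖F 1‖ * ‖a‖) ^ 2 := by rw [CStarRing.norm_star_mul_self]; ring

theorem apply_one_eq_norm (hF : ∀ a, 0 ≤ a → 0 ≤ F a) : F 1 = (‖F‖ : ℂ) := by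
  have norm_apply_one : ‖F‖ = ‖F 1‖ := by
    refine le_antisymm
      (F.opNorm_le_bound (norm_nonneg _) (norm_apply_le_norm_apply_one_mul hF)) ?_
    rcases subsingleton_or_nontrivial A with _ | _
    · rw [Subsingleton.elim (1 : A) 0, map_zero, norm_zero]
      exact norm_nonneg F
    · simpa using F.le_opNorm 1
  rw [norm_apply_one]
  exact Complex.eq_coe_norm_of_nonneg (hF 1 zero_le_one)

theorem apply_eq_apply_compression (hF : ∀ a, 0 ≤ a → 0 ≤ F a) {p : A} (hp : IsStarProjection p)
    (hFp : F p = F 1) (a : A) : F a = F (p * a * p) := by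
  have hq := hp.one_sub
  have apply_compl : F (star (1 - p) * (1 - p)) = 0 := by
    rw [hq.isSelfAdjoint.star_eq, hq.isIdempotentElem.eq, map_sub, hFp, sub_self]
  have left : ∀ b, F ((1 - p) * b) = 0 := fun b => by
    have := norm_apply_star_mul_sq_le hF (1 - p) b
    rw [apply_compl, norm_zero, zero_mul, hq.isSelfAdjoint.star_eq] at this
    exact norm_eq_zero.1 (sq_eq_zero_iff.1 (le_antisymm this (sq_nonneg _)))
  have right : ∀ b, F (b * (1 - p)) = 0 := fun b => by
    have := norm_apply_star_mul_sq_le hF (star b) (1 - p)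
    rw [apply_compl, norm_zero, mul_zero, star_star] at this
    exact norm_eq_zero.1 (sq_eq_zero_iff.1 (le_antisymm this (sq_nonneg _)))
  have decomposition : a = (1 - p) * a + p * a * (1 - p) + p * a * p := by noncomm_ring
  conv_lhs => rw [decomposition, map_add, map_add, left, right, zero_add, zero_add]

end PositiveFunctionals

/-! ## Vector states -/

section VectorStates

variable {H : Type*} [NormedAddCommGroup H] [InnerProductSpace ℂ H]

/-- The functional `B ↦ ⟨ψ|B|ψ⟩`, which is the vector state of `ψ` when `ψ` is a unit vector. -/
noncomputable def vectorFunctional (ψ : H) : StrongDual ℂ (H →L[ℂ] H) :=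
  (innerSL ℂ ψ).comp (ContinuousLinearMap.apply ℂ H ψ)

@[simp]
theorem vectorFunctional_apply (ψ : H) (B : H →L[ℂ] H) :
    vectorFunctional ψ B = inner ℂ ψ (B ψ) := rfl

theorem vectorFunctional_mem_traceClassFunctionals (ψ : H) :
    vectorFunctional ψ ∈ traceClassFunctionals H := by
  refine ⟨Pi.single 0 ψ, fun _ => ψ, ?_, fun B => ?_⟩
  · refine summable_of_ne_finset_zero (s := {0}) fun n hn => ?_
    simp [Pi.single_eq_of_ne (Finset.notMem_singleton.1 hn)]
  · convert hasSum_single (f := fun n : ℕ => inner ℂ ((Pi.single 0 ψ : ℕ → H) n) (B ψ)) 0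
      fun n hn => by simp [Pi.single_eq_of_ne hn] using 1
    simp

theorem vectorFunctional_mem_generalizedStateCone (ψ : H) :
    vectorFunctional ψ ∈ generalizedStateCone H :=
  ⟨subset_closure ⟨_, vectorFunctional_mem_traceClassFunctionals ψ, rfl⟩,
    fun _ hB => hB.inner_nonneg_right ψ⟩

theorem zero_mem_generalizedStateCone : 0 ∈ generalizedStateCone H := by
  have : vectorFunctional (0 : H) = 0 := by ext; simp
  exact this ▸ vectorFunctional_mem_generalizedStateCone (0 : H)

theorem apply_nonneg_of_mem_generalizedStateCone {F : StrongDual ℂ (H →L[ℂ] H)}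
    (hF : F ∈ generalizedStateCone H) (B : H →L[ℂ] H) (hB : 0 ≤ B) : 0 ≤ F B :=
  hF.2 B ((ContinuousLinearMap.nonneg_iff_isPositive B).1 hB)

variable [CompleteSpace H]

theorem apply_one_eq_norm_of_mem_generalizedStateCone {F : StrongDual ℂ (H →L[ℂ] H)}
    (hF : F ∈ generalizedStateCone H) : F 1 = (‖F‖ : ℂ) :=
  apply_one_eq_norm (apply_nonneg_of_mem_generalizedStateCone hF)

theorem apply_one_eq_one_of_mem_generalizedStates {F : StrongDual ℂ (H →L[ℂ] H)}
    (hF : F ∈ generalizedStates H) : F 1 = 1 := by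
  rw [apply_one_eq_norm_of_mem_generalizedStateCone hF.1, hF.2, Complex.ofReal_one]

theorem vectorFunctional_mem_generalizedStates {ψ : H} (hψ : ‖ψ‖ = 1) :
    vectorFunctional ψ ∈ generalizedStates H := by
  have hcone := vectorFunctional_mem_generalizedStateCone ψ
  refine ⟨hcone, Complex.ofReal_injective ?_⟩
  rw [← apply_one_eq_norm_of_mem_generalizedStateCone hcone]
  simp [hψ]

theorem eq_vectorFunctional_of_apply_rankOne_eq_one {ψ : H} (hψ : ‖ψ‖ = 1)
    {F : StrongDual ℂ (H →L[ℂ] H)} (hF : F ∈ generalizedStates H)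
    (hFψ : F (InnerProductSpace.rankOne ℂ ψ ψ) = 1) : F = vectorFunctional ψ := by
  set P : H →L[ℂ] H := InnerProductSpace.rankOne ℂ ψ ψ with hP
  ext B
  have compression : P * B * P = inner ℂ ψ (B ψ) • P := by
    ext x
    simp [hP, smul_smul, mul_comm]
  rw [apply_eq_apply_compression (apply_nonneg_of_mem_generalizedStateCone hF.1)
    (InnerProductSpace.isStarProjection_rankOne_self hψ)
    (hFψ.trans (apply_one_eq_one_of_mem_generalizedStates hF).symm) B]
  rw [← hP, compression, map_smul, hFψ, smul_eq_mul, mul_one, vectorFunctional_apply]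

theorem vectorFunctional_mem_exposedPoints {ψ : H} (hψ : ‖ψ‖ = 1) :
    vectorFunctional ψ ∈ (generalizedStates H).exposedPoints ℝ := by
  set P : H →L[ℂ] H := InnerProductSpace.rankOne ℂ ψ ψ with hP
  have apply_vectorFunctional : vectorFunctional ψ P = 1 := by simp [hP, hψ]
  have norm_apply_le : ∀ F ∈ generalizedStates H, ‖F P‖ ≤ 1 := fun F hF => by
    simpa [hP, hψ, hF.2] using F.le_opNorm P
  refine ⟨vectorFunctional_mem_generalizedStates hψ, Complex.reCLM.comp (evalPairing H P),
    fun F hF => ⟨?_, fun hle => ?_⟩⟩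
  · change (F P).re ≤ (vectorFunctional ψ P).re
    rw [apply_vectorFunctional]
    exact (Complex.re_le_norm _).trans (norm_apply_le F hF)
  · change (vectorFunctional ψ P).re ≤ (F P).re at hle
    rw [apply_vectorFunctional, Complex.one_re] at hle
    refine eq_vectorFunctional_of_apply_rankOne_eq_one hψ hF ?_
    have nonneg : 0 ≤ F P := hF.1.2 _ (InnerProductSpace.isPositive_rankOne_self ψ)
    rw [Complex.eq_coe_norm_of_nonneg nonneg,
      le_antisymm (norm_apply_le F hF) (hle.trans (Complex.re_le_norm _)), Complex.ofReal_one]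

theorem vectorFunctional_mem_pureGeneralizedStates {ψ : H} (hψ : ‖ψ‖ = 1) :
    vectorFunctional ψ ∈ pureGeneralizedStates H :=
  exposedPoints_subset_extremePoints (vectorFunctional_mem_exposedPoints hψ)

end VectorStates

/-! ## Generalized state-valued measures -/

section StateMeasures

variable {H Z : Type*} [NormedAddCommGroup H] [InnerProductSpace ℂ H] [MeasurableSpace Z]

theorem evalPairing_apply (B : H →L[ℂ] H) (F : StrongDual ℂ (H →L[ℂ] H)) :
    evalPairing H B F = F B := rfl

theorem isGeneralizedStateMeasure_dirac {F : StrongDual ℂ (H →L[ℂ] H)}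
    (hF : F ∈ generalizedStateCone H) (z : Z) :
    IsGeneralizedStateMeasure (VectorMeasure.dirac z F) := by
  intro S hS
  by_cases hz : z ∈ S
  · rwa [VectorMeasure.dirac_apply_of_mem hS hz]
  · rw [VectorMeasure.dirac_apply_of_notMem hz]
    exact zero_mem_generalizedStateCone

variable [CompleteSpace H] {n : VectorMeasure Z (StrongDual ℂ (H →L[ℂ] H))}

namespace IsGeneralizedStateMeasure

-- On positive functionals `‖F‖ = F 1`, so the norm of `n` is itself a finite measure.
theorem isFiniteMeasure_variation (hn : IsGeneralizedStateMeasure n) :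
    IsFiniteMeasure (VectorMeasure.variation (V := StrongDual ℂ (H →L[ℂ] H)) n) := by
  let evalOne : StrongDual ℂ (H →L[ℂ] H) →L[ℝ] ℝ := Complex.reCLM.comp (evalPairing H 1)
  let normMeasure : SignedMeasure Z :=
    n.mapRange evalOne.toLinearMap.toAddMonoidHom evalOne.continuous
  have apply_eq : ∀ S, MeasurableSet S → normMeasure S = ‖n S‖ := fun S hS =>
    congrArg Complex.re (apply_one_eq_norm_of_mem_generalizedStateCone (hn S hS))
  have nonneg : VectorMeasure.restrict (0 : SignedMeasure Z) Set.univ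
      ≤ normMeasure.restrict Set.univ := by
    rw [VectorMeasure.le_restrict_univ_iff_le, VectorMeasure.le_iff]
    intro S hS
    rw [apply_eq S hS]
    exact norm_nonneg _
  refine isFiniteMeasure_of_le (normMeasure.toMeasureOfZeroLE Set.univ MeasurableSet.univ nonneg) <|
    VectorMeasure.variation_le_of_forall_enorm_le fun S hS => le_of_eq ?_
  rw [SignedMeasure.toMeasureOfZeroLE_apply _ _ _ hS, ← ofReal_norm, ENNReal.ofReal,
    ENNReal.coe_inj, NNReal.eq_iff, Real.coe_toNNReal _ (norm_nonneg _)]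
  simp [apply_eq S hS]

theorem apply_univ_le_integral (hn : IsGeneralizedStateMeasure n) {G : Z → H →L[ℂ] H}
    (hG : n.Integrable G) {A : H →L[ℂ] H} (hA : ∀ z, A ≤ G z) :
    n Set.univ A ≤ n.integral G (evalPairing H) := by
  have := hn.isFiniteMeasure_variation
  calc n Set.univ A = n.integral (fun _ => A) (evalPairing H) := by
        rw [VectorMeasure.integral_const, evalPairing_apply]
    _ ≤ n.integral G (evalPairing H) :=
        setToFun_mono _
          (fun S hS _ => apply_nonneg_of_mem_generalizedStateCone (hn S hS))
          (integrable_const A) hG (Eventually.of_forall hA)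

end IsGeneralizedStateMeasure

end StateMeasures

/-! ## Equality of the variational problems -/

namespace QuasiClassicalForms

variable {H Z : Type*} [NormedAddCommGroup H] [InnerProductSpace ℂ H]
  {M : QuasiClassicalForms H Z}

/-- All Hamiltonians `ℋ_z` are form bounded with respect to `𝒯 = 𝒦₀ + 1`: the operators `𝒯^{-1/2}`
and `𝒯^{-1/2} ℋ_z 𝒯^{-1/2}` exist and are bounded. -/
def IsFormBounded (M : QuasiClassicalForms H Z) : Prop :=
  ∃ R, M.IsInvSqrt R ∧ ∀ z, ∃ G, M.IsSandwich R z G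

theorem energyGQC_le_energyGQCPure : M.energyGQC ≤ M.energyGQCPure := by
  refine sInf_le_sInf ?_
  rintro _ ⟨ρ, z, e, hρ, h⟩
  exact ⟨ρ, z, e, hρ.1, h⟩

theorem IsSandwich.energyForm_smul {R G : H →L[ℂ] H} {z : Z} (hG : M.IsSandwich R z G)
    (c : ℂ) (φ : H) : M.energyForm z (c • R φ) = ‖c‖ ^ 2 * M.energyForm z (R φ) := by
  have h := hG (c • φ)
  rw [map_smul, inner_smul_left, inner_smul_right, hG φ, ← mul_assoc, Complex.conj_mul',
    map_smul] at h
  exact_mod_cast h.symm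

variable {R G : H →L[ℂ] H} {z : Z} {E : ℝ}

theorem IsInvSqrt.apply_mem_formDomain (hR : M.IsInvSqrt R) (φ : H) : R φ ∈ M.formDomain :=
  hR.2.1 ▸ Set.mem_range_self φ

theorem IsInvSqrt.inner_apply_left (hR : M.IsInvSqrt R) (φ ψ : H) :
    inner ℂ (R φ) ψ = inner ℂ φ (R ψ) :=
  hR.1.isSymmetric φ ψ

theorem IsSandwich.le_energyForm (hR : M.IsInvSqrt R) (hG : M.IsSandwich R z G)
    (hE : (E : EReal) ≤ M.energyQC) (φ : H) : E * ‖R φ‖ ^ 2 ≤ M.energyForm z (R φ) := by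
  rcases eq_or_ne (R φ) 0 with hφ | hφ
  · have := hG.energyForm_smul 0 φ
    rw [norm_zero, zero_pow two_ne_zero, zero_mul, zero_smul] at this
    rw [hφ, this, norm_zero, zero_pow two_ne_zero, mul_zero]
  set c : ℂ := ((‖R φ‖⁻¹ : ℝ) : ℂ) with hc
  have norm_c : ‖c‖ = ‖R φ‖⁻¹ := by rw [hc, Complex.norm_real, norm_inv, norm_norm]
  have normalized : ‖c • R φ‖ = 1 := by
    rw [norm_smul, norm_c, inv_mul_cancel₀ (norm_ne_zero_iff.2 hφ)]
  have lower : (E : EReal) ≤ (M.energyForm z (c • R φ) : ℝ) :=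
    hE.trans (sInf_le ⟨c • R φ, z, normalized, map_smul R c φ ▸ hR.apply_mem_formDomain _, rfl⟩)
  rwa [EReal.coe_le_coe_iff, hG.energyForm_smul, norm_c, inv_pow, inv_mul_eq_div,
    le_div_iff₀ (pow_pos (norm_pos_iff.2 hφ) 2)] at lower

theorem IsSandwich.smul_comp_le (hR : M.IsInvSqrt R) (hG : M.IsSandwich R z G)
    (hE : (E : EReal) ≤ M.energyQC) : (E : ℂ) • (R ∘L R) ≤ G := by
  rw [ContinuousLinearMap.le_def, ContinuousLinearMap.isPositive_iff_complex]
  intro φ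
  have form : inner ℂ φ ((G - (E : ℂ) • (R ∘L R)) φ)
      = ((M.energyForm z (R φ) - E * ‖R φ‖ ^ 2 : ℝ) : ℂ) := by
    rw [sub_apply, smul_apply, ContinuousLinearMap.comp_apply, inner_sub_right, inner_smul_right,
      hG φ, ← hR.inner_apply_left, inner_self_eq_norm_sq_to_K]
    push_cast
    rfl
  rw [← inner_conj_symm, form, Complex.conj_ofReal]
  exact ⟨rfl, sub_nonneg.2 (hG.le_energyForm hR hE φ)⟩

variable [CompleteSpace H]

theorem energyQC_le_energyGQC : M.energyQC ≤ M.energyGQC := by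
  refine le_sInf ?_
  rintro _ ⟨ρ, z, e, hρ, ⟨R, G, ρT, hR, hG, hρT, hρρT, he⟩, rfl⟩
  refine EReal.ge_of_forall_gt_iff_ge.1 fun E hE => ?_
  have normalization : ρT (R ∘L R) = 1 :=
    (hρρT 1).trans (apply_one_eq_one_of_mem_generalizedStates hρ)
  have lower : 0 ≤ ρT (G - (E : ℂ) • (R ∘L R)) :=
    apply_nonneg_of_mem_generalizedStateCone hρT _ (sub_nonneg.2 (hG.smul_comp_le hR hE.le))
  rw [map_sub, map_smul, he, normalization, smul_eq_mul, mul_one, sub_nonneg] at lower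
  exact_mod_cast lower

theorem energyGQCPure_le_energyQC (hM : M.IsFormBounded) : M.energyGQCPure ≤ M.energyQC := by
  obtain ⟨R, hR, hG⟩ := hM
  refine le_sInf ?_
  rintro _ ⟨ψ, z, hψ, hψM, rfl⟩
  obtain ⟨φ, rfl⟩ := hR.2.1.symm ▸ hψM
  obtain ⟨G, hG⟩ := hG z
  exact sInf_le ⟨vectorFunctional (R φ), z, _, vectorFunctional_mem_pureGeneralizedStates hψ,
    ⟨R, G, vectorFunctional φ, hR, hG, vectorFunctional_mem_generalizedStateCone φ,
      fun B => (hR.inner_apply_left φ (B (R φ))).symm, hG φ⟩, rfl⟩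

variable [MeasurableSpace Z]

theorem energyQC_le_energyGSVM : M.energyQC ≤ M.energyGSVM := by
  refine le_sInf ?_
  rintro _ ⟨n, e, hn, hn1, ⟨R, G, nT, hR, hG, hnT, hnnT, hint, he⟩, rfl⟩
  refine EReal.ge_of_forall_gt_iff_ge.1 fun E hE => ?_
  have normalization : nT Set.univ (R ∘L R) = 1 :=
    (hnnT Set.univ MeasurableSet.univ 1).trans
      (apply_one_eq_one_of_mem_generalizedStates ⟨hn _ MeasurableSet.univ, hn1⟩)
  have lower := hnT.apply_univ_le_integral hint fun z => (hG z).smul_comp_le hR hE.le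
  rw [map_smul, he, normalization, smul_eq_mul, mul_one] at lower
  exact_mod_cast lower

variable [MeasurableSingletonClass Z]

theorem hasGeneralizedMeasureEnergy_dirac (hR : M.IsInvSqrt R) {G : Z → H →L[ℂ] H}
    (hG : ∀ z, M.IsSandwich R z (G z)) (z : Z) (φ : H) :
    M.HasGeneralizedMeasureEnergy (VectorMeasure.dirac z (vectorFunctional (R φ)))
      (M.energyForm z (R φ)) := by
  refine ⟨R, G, VectorMeasure.dirac z (vectorFunctional φ), hR, hG,
    isGeneralizedStateMeasure_dirac (vectorFunctional_mem_generalizedStateCone φ) z,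
    fun S hS B => ?_, ?_, ?_⟩
  · by_cases hz : z ∈ S
    · rw [VectorMeasure.dirac_apply_of_mem hS hz, VectorMeasure.dirac_apply_of_mem hS hz]
      exact (hR.inner_apply_left φ (B (R φ))).symm
    · rw [VectorMeasure.dirac_apply_of_notMem hz, VectorMeasure.dirac_apply_of_notMem hz]
      rfl
  · rw [VectorMeasure.Integrable, VectorMeasure.variation_dirac]
    exact (integrable_dirac enorm_lt_top).smul_measure enorm_ne_top
  · rw [VectorMeasure.integral_dirac, evalPairing_apply]
    exact hG z φ

theorem energyGSVM_le_energyQC (hM : M.IsFormBounded) : M.energyGSVM ≤ M.energyQC := by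
  obtain ⟨R, hR, hG⟩ := hM
  choose G hG using hG
  refine le_sInf ?_
  rintro _ ⟨ψ, z, hψ, hψM, rfl⟩
  obtain ⟨φ, rfl⟩ := hR.2.1.symm ▸ hψM
  refine sInf_le ⟨VectorMeasure.dirac z (vectorFunctional (R φ)), _,
    isGeneralizedStateMeasure_dirac (vectorFunctional_mem_generalizedStateCone _) z, ?_,
    hasGeneralizedMeasureEnergy_dirac hR hG z φ, rfl⟩
  rw [VectorMeasure.dirac_apply_of_mem MeasurableSet.univ (Set.mem_univ z)]
  exact (vectorFunctional_mem_generalizedStates hψ).2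

theorem energies_eq (hM : M.IsFormBounded) :
    M.energyQC = M.energyGQC ∧ M.energyGQC = M.energyGSVM ∧ M.energyGQCPure = M.energyQC := by
  have qc_eq_gqc : M.energyQC = M.energyGQC := le_antisymm energyQC_le_energyGQC
    (energyGQC_le_energyGQCPure.trans (energyGQCPure_le_energyQC hM))
  exact ⟨qc_eq_gqc,
    qc_eq_gqc ▸ le_antisymm energyQC_le_energyGSVM (energyGSVM_le_energyQC hM),
    le_antisymm (energyGQCPure_le_energyQC hM) (qc_eq_gqc.le.trans energyGQC_le_energyGQCPure)⟩

end QuasiClassicalForms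

/-! ## The inverse square root of the operator of a closed form -/

section InverseSquareRoot

theorem denseRange_iff_injective_adjoint {𝕜 E F : Type*} [RCLike 𝕜] [NormedAddCommGroup E]
    [InnerProductSpace 𝕜 E] [CompleteSpace E] [NormedAddCommGroup F] [InnerProductSpace 𝕜 F]
    [CompleteSpace F] (T : E →L[𝕜] F) : DenseRange T ↔ Function.Injective T.adjoint := by
  have range_coe : Set.range T = (T.range : Set F) := T.coe_range.symm
  rw [DenseRange, range_coe, Submodule.dense_iff_topologicalClosure_eq_top,
    Submodule.topologicalClosure_eq_top_iff, ContinuousLinearMap.orthogonal_range]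
  exact LinearMap.ker_eq_bot

section PolarDecomposition

variable {H Q : Type*} [NormedAddCommGroup H] [InnerProductSpace ℂ H] [CompleteSpace H]
  [NormedAddCommGroup Q] [InnerProductSpace ℂ Q] [CompleteSpace Q]

theorem norm_sqrt_comp_adjoint_apply (J : Q →L[ℂ] H) (x : H) :
    ‖CFC.sqrt (J ∘L J.adjoint) x‖ = ‖J.adjoint x‖ := by
  set A := J ∘L J.adjoint
  have self_adjoint : (CFC.sqrt A).adjoint = CFC.sqrt A :=
    (CFC.sqrt_nonneg A).isSelfAdjoint.adjoint_eq
  have nonneg : 0 ≤ A :=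
    (ContinuousLinearMap.nonneg_iff_isPositive _).2 J.isPositive_self_comp_adjoint
  have squared : (CFC.sqrt A).adjoint ∘L CFC.sqrt A = J.adjoint.adjoint ∘L J.adjoint := by
    rw [self_adjoint, J.adjoint_adjoint]
    exact CFC.sqrt_mul_sqrt_self A nonneg
  rw [ContinuousLinearMap.apply_norm_eq_sqrt_inner_adjoint_left, squared,
    ← ContinuousLinearMap.apply_norm_eq_sqrt_inner_adjoint_left]

theorem exists_isPositive_eq_comp_linearIsometryEquiv (J : Q →L[ℂ] H)
    (hJ : Function.Injective J) (hJd : DenseRange J) :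
    ∃ (R : H →L[ℂ] H) (U : H ≃ₗᵢ[ℂ] Q), R.IsPositive ∧ ∀ x, R x = J (U x) := by
  set A := J ∘L J.adjoint
  have nonneg : 0 ≤ A :=
    (ContinuousLinearMap.nonneg_iff_isPositive _).2 J.isPositive_self_comp_adjoint
  have positive : (CFC.sqrt A).IsPositive :=
    (ContinuousLinearMap.nonneg_iff_isPositive _).1 (CFC.sqrt_nonneg A)
  have dense_sqrt : DenseRange ⇑(CFC.sqrt A : H →L[ℂ] H) := by
    rw [denseRange_iff_injective_adjoint, positive.isSelfAdjoint.adjoint_eq,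
      injective_iff_map_eq_zero]
    intro x hx
    rw [← norm_eq_zero, norm_sqrt_comp_adjoint_apply, norm_eq_zero] at hx
    exact (denseRange_iff_injective_adjoint J).1 hJd (hx.trans (map_zero _).symm)
  have dense_adjoint : DenseRange J.adjoint := by
    rwa [denseRange_iff_injective_adjoint, J.adjoint_adjoint]
  let U : H ≃ₗᵢ[ℂ] Q := (LinearEquiv.refl ℂ H).extendOfIsometry (CFC.sqrt A).toLinearMap
    J.adjoint.toLinearMap dense_sqrt dense_adjoint fun x =>
      (norm_sqrt_comp_adjoint_apply J x).symm
  have apply_sqrt : ∀ x, U (CFC.sqrt A x) = J.adjoint x :=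
    LinearEquiv.extendOfIsometry_eq (LinearEquiv.refl ℂ H) _ _ _ _ _
  refine ⟨CFC.sqrt A, U, positive, congrFun ?_⟩
  refine dense_sqrt.equalizer (by fun_prop) (by fun_prop) (funext fun x => ?_)
  change (CFC.sqrt A * CFC.sqrt A) x = J (U (CFC.sqrt A x))
  rw [CFC.sqrt_mul_sqrt_self A nonneg, apply_sqrt]
  rfl

theorem exists_isPositive_eq_comp_linearIsometry {E : Type*} [NormedAddCommGroup E]
    [InnerProductSpace ℂ E] [CompleteSpace E] (P : E →L[ℂ] H) {V : Submodule ℂ E}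
    (hV : IsClosed (V : Set E)) (hinj : ∀ q ∈ V, P q = 0 → q = 0) (hd : Dense (P '' V)) :
    ∃ (R : H →L[ℂ] H) (U : H →ₗᵢ[ℂ] E), R.IsPositive ∧ Set.range U = V ∧ ∀ x, R x = P (U x) := by
  have : CompleteSpace V := hV.completeSpace_coe
  have injective : Function.Injective (P.comp V.subtypeL) :=
    (injective_iff_map_eq_zero _).2 fun q hq => Subtype.ext (hinj q q.2 hq)
  have dense : DenseRange (P.comp V.subtypeL) := by
    rwa [Set.image_eq_range] at hd
  obtain ⟨R, U, positive, factorization⟩ :=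
    exists_isPositive_eq_comp_linearIsometryEquiv _ injective dense
  refine ⟨R, V.subtypeₗᵢ.comp U.toLinearIsometry, positive, ?_, factorization⟩
  rw [LinearIsometry.coe_comp, U.coe_toLinearIsometry, U.surjective.range_comp]
  exact Subtype.range_coe

end PolarDecomposition

section JointGraph

variable {H : Type*} [NormedAddCommGroup H] [InnerProductSpace ℂ H]
  {ι : Type*} {K : ι → Type*} [∀ i, NormedAddCommGroup (K i)]
  [∀ i, InnerProductSpace ℂ (K i)]

/-- The joint graph of a family of operators: all `(x, (T i x)ᵢ)` with `x` in every domain, with the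
norm of `𝒬(1 + ∑ᵢ (T i)* (T i))`. -/
def jointGraph (T : ∀ i, H →ₗ.[ℂ] K i) : Submodule ℂ (WithLp 2 (H × PiLp 2 K)) where
  carrier := {q | ∀ i, (q.fst, q.snd i) ∈ (T i).graph}
  add_mem' hp hq i := (T i).graph.add_mem (hp i) (hq i)
  zero_mem' i := (T i).graph.zero_mem
  smul_mem' c _ hq i := (T i).graph.smul_mem c (hq i)

namespace jointGraph

variable {T : ∀ i, H →ₗ.[ℂ] K i}

theorem eq_zero_of_fst_eq_zero {q : WithLp 2 (H × PiLp 2 K)} (hq : q ∈ jointGraph T)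
    (h : q.fst = 0) : q = 0 := by
  have snd_eq : q.snd = 0 := PiLp.ext fun i => (T i).graph_fst_eq_zero_snd (hq i) h
  exact WithLp.ofLp_injective 2 (Prod.ext h snd_eq)

theorem image_fst : WithLp.fst '' (jointGraph T : Set (WithLp 2 (H × PiLp 2 K)))
    = (⨅ i, (T i).domain : Submodule ℂ H) := by
  ext x
  simp only [SetLike.mem_coe, Submodule.mem_iInf, LinearPMap.mem_domain_iff]
  constructor
  · rintro ⟨q, hq, rfl⟩ i
    exact ⟨_, hq i⟩
  · intro hx
    choose y hy using hx
    exact ⟨WithLp.toLp 2 (x, WithLp.toLp 2 y), hy, rfl⟩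

theorem isClosed (hT : ∀ i, (T i).IsClosed) :
    IsClosed (jointGraph T : Set (WithLp 2 (H × PiLp 2 K))) := by
  have : (jointGraph T : Set (WithLp 2 (H × PiLp 2 K)))
      = ⋂ i, (fun q => (q.fst, q.snd i)) ⁻¹' ((T i).graph : Set (H × K i)) := by
    ext q
    simp only [Set.mem_iInter]
    rfl
  rw [this]
  exact isClosed_iInter fun i => (hT i).preimage (by fun_prop)

end jointGraph

/-- Von Neumann's theorem on `1 + ∑ᵢ (T i)* (T i)`, whose inverse square root is `R`. -/
theorem exists_isPositive_range_eq_iInf_domain [Fintype ι] [CompleteSpace H]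
    [∀ i, CompleteSpace (K i)] {T : ∀ i, H →ₗ.[ℂ] K i} (hT : ∀ i, (T i).IsClosed)
    (hd : Dense ((⨅ i, (T i).domain : Submodule ℂ H) : Set H)) :
    ∃ (R : H →L[ℂ] H) (S : ∀ i, H →L[ℂ] K i), R.IsPositive ∧
      Set.range R = (⨅ i, (T i).domain : Submodule ℂ H) ∧ (∀ i φ, (R φ, S i φ) ∈ (T i).graph) ∧
      ∀ φ, ‖R φ‖ ^ 2 + ∑ i, ‖S i φ‖ ^ 2 = ‖φ‖ ^ 2 := by
  obtain ⟨R, U, positive, range_eq, factorization⟩ :=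
    exists_isPositive_eq_comp_linearIsometry (WithLp.fstL 2 ℂ H (PiLp 2 K))
      (jointGraph.isClosed hT) (fun _ => jointGraph.eq_zero_of_fst_eq_zero)
      (jointGraph.image_fst (T := T) ▸ hd)
  have mem_jointGraph : ∀ φ, U φ ∈ jointGraph T := fun φ =>
    range_eq.subset (Set.mem_range_self φ)
  refine ⟨R, fun i => (PiLp.proj 2 K i).comp ((WithLp.sndL 2 ℂ H (PiLp 2 K)).comp
    U.toContinuousLinearMap), positive, ?_, fun i φ => ?_, fun φ => ?_⟩
  · rw [← jointGraph.image_fst, ← range_eq, ← Set.range_comp]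
    exact congrArg Set.range (funext factorization)
  · rw [factorization]
    exact mem_jointGraph φ i
  · rw [factorization, ← U.norm_map φ, WithLp.prod_norm_sq_eq_of_L2, PiLp.norm_sq_eq_of_L2]
    rfl

end JointGraph

end InverseSquareRoot

/-! ## Closed operators on `L²` -/

section Scaling

variable {𝕜 E F : Type*} [Field 𝕜] [AddCommGroup E] [Module 𝕜 E] [AddCommGroup F] [Module 𝕜 F]
  {T : E →ₗ.[𝕜] F} {a : 𝕜}

theorem mem_graph_smul_linearPMap (ha : a ≠ 0) {x : E} {y : F} :
    (x, y) ∈ (a • T).graph ↔ (x, a⁻¹ • y) ∈ T.graph := by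
  simp only [LinearPMap.mem_graph_iff, LinearPMap.smul_apply, eq_inv_smul_iff₀ ha]
  rfl

theorem isClosed_smul_linearPMap [TopologicalSpace E] [TopologicalSpace F]
    [ContinuousConstSMul 𝕜 F] (hT : T.IsClosed) (ha : a ≠ 0) : (a • T).IsClosed := by
  have graph_eq : ((a • T).graph : Set (E × F))
      = (fun q => (q.1, a⁻¹ • q.2)) ⁻¹' (T.graph : Set (E × F)) :=
    Set.ext fun _ => mem_graph_smul_linearPMap ha
  rw [LinearPMap.IsClosed, graph_eq]
  exact IsClosed.preimage (by fun_prop) hT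

end Scaling

section Multiplication

variable {𝕜 E α : Type*} [RCLike 𝕜] [NormedAddCommGroup E] [NormedSpace 𝕜 E] [MeasurableSpace α]
  {μ : Measure α} {p : ENNReal}

/-- Multiplication by an arbitrary function `m`, on its maximal domain in `Lᵖ`. -/
noncomputable def mulPMap (m : α → 𝕜) : Lp E p μ →ₗ.[𝕜] Lp E p μ :=
  Submodule.toLinearPMap
    { carrier := {q | q.2 =ᵐ[μ] fun x => m x • q.1 x}
      add_mem' := by
        intro q q' hq hq'
        filter_upwards [hq, hq', Lp.coeFn_add q.1 q'.1, Lp.coeFn_add q.2 q'.2] with x h h' h₁ h₂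
        rw [Prod.fst_add, Prod.snd_add, h₁, h₂, Pi.add_apply, Pi.add_apply, h, h', smul_add]
      zero_mem' := by
        filter_upwards [Lp.coeFn_zero E p μ] with x hx
        rw [Prod.fst_zero, Prod.snd_zero, hx, Pi.zero_apply, smul_zero]
      smul_mem' := by
        intro a q hq
        filter_upwards [hq, Lp.coeFn_smul a q.1, Lp.coeFn_smul a q.2] with x h h₁ h₂
        rw [Prod.smul_fst, Prod.smul_snd, h₁, h₂, Pi.smul_apply, Pi.smul_apply, h, smul_comm] }

theorem mem_graph_mulPMap {m : α → 𝕜} {q : Lp E p μ × Lp E p μ} :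
    q ∈ (mulPMap m).graph ↔ q.2 =ᵐ[μ] fun x => m x • q.1 x := by
  rw [mulPMap, Submodule.toLinearPMap_graph_eq]
  · rfl
  · intro q hq h
    rw [Lp.eq_zero_iff_ae_eq_zero]
    filter_upwards [hq, (Lp.eq_zero_iff_ae_eq_zero).1 h] with x hx h0
    rw [hx, h0, Pi.zero_apply, smul_zero]

theorem isClosed_mulPMap [Fact (1 ≤ p)] (m : α → 𝕜) :
    (mulPMap m : Lp E p μ →ₗ.[𝕜] Lp E p μ).IsClosed := by
  refine IsSeqClosed.isClosed fun q q₀ hq hlim => mem_graph_mulPMap.2 ?_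
  obtain ⟨φ, hφ, fst_lim⟩ :=
    (tendstoInMeasure_of_tendsto_Lp hlim.fst_nhds).exists_seq_tendsto_ae
  obtain ⟨φ', hφ', snd_lim⟩ := (tendstoInMeasure_of_tendsto_Lp
    (hlim.snd_nhds.comp hφ.tendsto_atTop)).exists_seq_tendsto_ae
  have graph : ∀ᵐ x ∂μ, ∀ n, (q n).2 x = m x • (q n).1 x :=
    ae_all_iff.2 fun n => mem_graph_mulPMap.1 (hq n)
  filter_upwards [fst_lim, snd_lim, graph] with x h₁ h₂ hx
  refine tendsto_nhds_unique h₂ ?_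
  simp only [Function.comp_apply, hx]
  exact (h₁.comp hφ'.tendsto_atTop).const_smul (m x)

end Multiplication

section WeakDerivatives

variable {N d : ℕ}

/-- A continuous real function with compact support, as an element of `L²`. -/
noncomputable def testVec (f : Config N d → ℝ) (hf : Continuous f) (hc : HasCompactSupport f) :
    ParticleSpace N d :=
  ((hf.memLp_of_hasCompactSupport (p := 2) (μ := volume) hc).ofReal (K := ℂ)).toLp

theorem coeFn_testVec {f : Config N d → ℝ} (hf : Continuous f) (hc : HasCompactSupport f) :
    testVec f hf hc =ᵐ[volume] fun X => (f X : ℂ) :=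
  MemLp.coeFn_toLp _

theorem inner_testVec {f : Config N d → ℝ} (hf : Continuous f) (hc : HasCompactSupport f)
    (ψ : ParticleSpace N d) : inner ℂ (testVec f hf hc) ψ = ∫ X, f X • ψ X := by
  rw [L2.inner_def]
  refine integral_congr_ae ?_
  filter_upwards [coeFn_testVec hf hc] with X hX
  rw [hX, RCLike.inner_apply, Complex.conj_ofReal, Complex.real_smul, mul_comm]

theorem integral_mul_testVec {f g : Config N d → ℝ} (hf : Continuous f)
    (hc : HasCompactSupport f) :
    ∫ X, g X • testVec f hf hc X = ((∫ X, f X * g X : ℝ) : ℂ) := by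
  rw [← integral_complex_ofReal]
  refine integral_congr_ae ?_
  filter_upwards [coeFn_testVec hf hc] with X hX
  rw [hX, Complex.real_smul, Complex.ofReal_mul, mul_comm]

theorem eq_zero_of_inner_testVec_eq_zero {ψ : ParticleSpace N d}
    (h : ∀ (f : Config N d → ℝ) (hf : ContDiff ℝ (⊤ : ℕ∞) f) (hc : HasCompactSupport f),
      inner ℂ (testVec f hf.continuous hc) ψ = 0) : ψ = 0 := by
  rw [Lp.eq_zero_iff_ae_eq_zero]
  refine ae_eq_zero_of_integral_contDiff_smul_eq_zero
    ((Lp.memLp ψ).locallyIntegrable one_le_two) fun f hf hc => ?_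
  rw [← inner_testVec hf.continuous hc]
  exact h f hf hc

theorem continuous_fderiv_coordVec {f : Config N d → ℝ} (hf : ContDiff ℝ (⊤ : ℕ∞) f) (j : Fin N)
    (l : Fin d) : Continuous fun X => fderiv ℝ f X (coordVec j l) :=
  (hf.continuous_fderiv (by simp)).clm_apply continuous_const

theorem hasWeakPartial_iff_inner {ψ g : ParticleSpace N d} {j : Fin N} {l : Fin d} :
    HasWeakPartial ψ j l g ↔ ∀ (f : Config N d → ℝ) (hf : ContDiff ℝ (⊤ : ℕ∞) f)
      (hc : HasCompactSupport f),
      inner ℂ (testVec _ (continuous_fderiv_coordVec hf j l) (hc.fderiv_apply ℝ (coordVec j l))) ψ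
        = -inner ℂ (testVec f hf.continuous hc) g := by
  simp only [inner_testVec, HasWeakPartial]

theorem hasWeakPartial_testVec {f : Config N d → ℝ} (hf : ContDiff ℝ (⊤ : ℕ∞) f)
    (hc : HasCompactSupport f) (j : Fin N) (l : Fin d) :
    HasWeakPartial (testVec f hf.continuous hc) j l
      (testVec _ (continuous_fderiv_coordVec hf j l) (hc.fderiv_apply ℝ (coordVec j l))) := by
  intro φ hφ hφc
  have continuous_f' := continuous_fderiv_coordVec hf j l
  have continuous_φ' := continuous_fderiv_coordVec hφ j l
  rw [integral_mul_testVec, integral_mul_testVec, ← Complex.ofReal_neg]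
  congr 1
  refine integral_mul_fderiv_eq_neg_fderiv_mul_of_integrable ?_ ?_ ?_
    (fun X _ => (hf.differentiable (by simp)) X) (fun X _ => (hφ.differentiable (by simp)) X)
  · exact (continuous_f'.mul hφ.continuous).integrable_of_hasCompactSupport hφc.mul_left
  · exact (hf.continuous.mul continuous_φ').integrable_of_hasCompactSupport hc.mul_right
  · exact (hf.continuous.mul hφ.continuous).integrable_of_hasCompactSupport hc.mul_right

/-- The operator `∂_{j,l}` of `L²`, on its maximal domain. -/
noncomputable def weakPartialPMap (j : Fin N) (l : Fin d) :
    ParticleSpace N d →ₗ.[ℂ] ParticleSpace N d :=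
  Submodule.toLinearPMap
    { carrier := {q | HasWeakPartial q.1 j l q.2}
      add_mem' := by
        intro q q' hq hq'
        rw [Set.mem_ofPred_eq, hasWeakPartial_iff_inner] at *
        intro f hf hc
        rw [Prod.fst_add, Prod.snd_add, inner_add_right, inner_add_right, hq f hf hc, hq' f hf hc,
          neg_add]
      zero_mem' := by
        rw [Set.mem_ofPred_eq, hasWeakPartial_iff_inner]
        intro f hf hc
        rw [Prod.fst_zero, Prod.snd_zero, inner_zero_right, inner_zero_right, neg_zero]
      smul_mem' := by
        intro a q hq
        rw [Set.mem_ofPred_eq, hasWeakPartial_iff_inner] at *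
        intro f hf hc
        rw [Prod.smul_fst, Prod.smul_snd, inner_smul_right, inner_smul_right, hq f hf hc,
          mul_neg] }

variable {j : Fin N} {l : Fin d}

theorem mem_graph_weakPartialPMap {ψ g : ParticleSpace N d} :
    (ψ, g) ∈ (weakPartialPMap j l).graph ↔ HasWeakPartial ψ j l g := by
  rw [weakPartialPMap, Submodule.toLinearPMap_graph_eq]
  · rfl
  · intro q hq hψ
    refine eq_zero_of_inner_testVec_eq_zero fun f hf hc => ?_
    rw [← neg_eq_zero, ← hasWeakPartial_iff_inner.1 hq f hf hc, hψ, inner_zero_right]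

theorem isClosed_weakPartialPMap : (weakPartialPMap j l).IsClosed := by
  have graph_eq : ((weakPartialPMap j l).graph : Set (ParticleSpace N d × ParticleSpace N d))
      = ⋂ (f : Config N d → ℝ) (hf : ContDiff ℝ (⊤ : ℕ∞) f) (hc : HasCompactSupport f),
        {q | inner ℂ (testVec _ (continuous_fderiv_coordVec hf j l)
            (hc.fderiv_apply ℝ (coordVec j l))) q.1
          = -inner ℂ (testVec f hf.continuous hc) q.2} := by
    ext ⟨ψ, g⟩
    simp only [SetLike.mem_coe, mem_graph_weakPartialPMap, hasWeakPartial_iff_inner,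
      Set.mem_iInter, Set.mem_ofPred_eq]
  rw [LinearPMap.IsClosed, graph_eq]
  exact isClosed_iInter fun f => isClosed_iInter fun hf => isClosed_iInter fun hc =>
    isClosed_eq (by fun_prop) (by fun_prop)

theorem HasWeakPartial.weakPartial_eq {ψ g : ParticleSpace N d} (h : HasWeakPartial ψ j l g) :
    weakPartial ψ j l = g := by
  have differentiable : ∃ g, HasWeakPartial ψ j l g := ⟨g, h⟩
  rw [weakPartial, dif_pos differentiable]
  exact LinearPMap.mem_graph_snd_inj _ (mem_graph_weakPartialPMap.2 differentiable.choose_spec)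
    (mem_graph_weakPartialPMap.2 h) rfl

end WeakDerivatives

section FormDomain

variable {N d : ℕ}

theorem testVec_mem_freeFormDomain {W : Config N d → ℝ} (hW : LocallyIntegrable W volume)
    {f : Config N d → ℝ} (hf : ContDiff ℝ (⊤ : ℕ∞) f) (hc : HasCompactSupport f) :
    testVec f hf.continuous hc ∈ freeFormDomain W := by
  refine ⟨fun j l => ⟨_, hasWeakPartial_testVec hf hc j l⟩, ?_⟩
  refine (hW.integrable_smul_right_of_hasCompactSupport (g := fun X => f X ^ 2)
    (hf.continuous.pow 2) (hc.comp_left (g := fun t : ℝ => t ^ 2) (zero_pow two_ne_zero))).congr ?_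
  filter_upwards [coeFn_testVec hf.continuous hc] with X hX
  rw [hX, Complex.norm_real, Real.norm_eq_abs, sq_abs, smul_eq_mul]

theorem Lp_norm_sq_eq_integral {α E : Type*} [MeasurableSpace α] {μ : Measure α}
    [NormedAddCommGroup E] (f : Lp E 2 μ) : ‖f‖ ^ 2 = ∫ x, ‖f x‖ ^ 2 ∂μ := by
  have nonneg : 0 ≤ ∫ x, ‖f x‖ ^ 2 ∂μ := integral_nonneg fun x => sq_nonneg _
  rw [Lp.norm_def, (Lp.memLp f).eLpNorm_eq_integral_rpow_norm two_ne_zero ENNReal.ofNat_ne_top]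
  simp only [ENNReal.toReal_ofNat, Real.rpow_ofNat]
  rw [ENNReal.toReal_ofReal (by positivity), ← Real.rpow_natCast, ← Real.rpow_mul nonneg]
  norm_num

/-- The operators `√W` and `√cⱼ ∂_{j,l}`, whose joint domain is the form domain of
`∑ⱼ cⱼ (-Δⱼ) + W` and whose squared norms add up to its form. -/
noncomputable def formRoots (c : Fin N → ℝ) (W : Config N d → ℝ) :
    Option (Fin N × Fin d) → (ParticleSpace N d →ₗ.[ℂ] ParticleSpace N d)
  | none => mulPMap fun X => (√(W X) : ℂ)
  | some (j, l) => (√(c j) : ℂ) • weakPartialPMap j l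

variable {c : Fin N → ℝ} {W : Config N d → ℝ}

theorem isClosed_formRoots (hc : ∀ j, 0 < c j) : ∀ i, (formRoots c W i).IsClosed
  | none => isClosed_mulPMap _
  | some (j, _) => isClosed_smul_linearPMap isClosed_weakPartialPMap
      (Complex.ofReal_ne_zero.2 (Real.sqrt_ne_zero'.2 (hc j)))

theorem norm_sq_sqrt_smul {E : Type*} [NormedAddCommGroup E] [NormedSpace ℂ E] {w : ℝ}
    (hw : 0 ≤ w) (x : E) : ‖(√w : ℂ) • x‖ ^ 2 = w * ‖x‖ ^ 2 := by
  rw [norm_smul, mul_pow, Complex.norm_real, Real.norm_eq_abs, sq_abs, Real.sq_sqrt hw]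

theorem norm_sq_ae_eq_of_ae_eq_sqrt_smul (hW : ∀ᵐ X, 0 ≤ W X) {ψ g : ParticleSpace N d}
    (h : g =ᵐ[volume] fun X => (√(W X) : ℂ) • ψ X) :
    (fun X => ‖g X‖ ^ 2) =ᵐ[volume] fun X => W X * ‖ψ X‖ ^ 2 := by
  filter_upwards [hW, h] with X hX hg
  rw [hg, norm_sq_sqrt_smul hX]

theorem iInf_domain_formRoots (hW : LocallyIntegrable W volume) (hW₀ : ∀ᵐ X, 0 ≤ W X) :
    ((⨅ i, (formRoots c W i).domain : Submodule ℂ (ParticleSpace N d)) : Set _)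
      = freeFormDomain W := by
  ext ψ
  have mem_mul : ψ ∈ (formRoots c W none).domain ↔ Integrable fun X => W X * ‖ψ X‖ ^ 2 := by
    simp only [formRoots, LinearPMap.mem_domain_iff, mem_graph_mulPMap]
    constructor
    · rintro ⟨g, hg⟩
      exact ((Lp.memLp g).integrable_norm_pow two_ne_zero).congr
        (norm_sq_ae_eq_of_ae_eq_sqrt_smul hW₀ hg)
    · intro h
      have measurable : AEStronglyMeasurable (fun X => (√(W X) : ℂ) • ψ X) volume := by
        have := hW.aestronglyMeasurable.aemeasurable.sqrt
        exact (Complex.continuous_ofReal.comp_aestronglyMeasurable this.aestronglyMeasurable).smul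
          (Lp.aestronglyMeasurable ψ)
      have memLp : MemLp (fun X => (√(W X) : ℂ) • ψ X) 2 volume := by
        rw [memLp_two_iff_integrable_sq_norm measurable]
        refine h.congr ?_
        filter_upwards [hW₀] with X hX
        rw [norm_sq_sqrt_smul hX]
      exact ⟨memLp.toLp, memLp.coeFn_toLp⟩
  have mem_partial : ∀ j l, ψ ∈ (formRoots c W (some (j, l))).domain ↔
      ∃ g, HasWeakPartial ψ j l g := fun j l =>
    (LinearPMap.mem_domain_iff (f := weakPartialPMap j l)).trans
      (exists_congr fun _ => mem_graph_weakPartialPMap)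
  simp only [SetLike.mem_coe, Submodule.mem_iInf, Option.forall, Prod.forall, mem_mul, mem_partial]
  exact and_comm

theorem dense_freeFormDomain (hW : LocallyIntegrable W volume) (hW₀ : ∀ᵐ X, 0 ≤ W X) :
    Dense (freeFormDomain W) := by
  rw [← iInf_domain_formRoots (c := 1) hW hW₀, Submodule.dense_iff_topologicalClosure_eq_top,
    Submodule.topologicalClosure_eq_top_iff, Submodule.eq_bot_iff]
  intro ψ hψ
  refine eq_zero_of_inner_testVec_eq_zero fun f hf hc => hψ _ ?_
  rw [← SetLike.mem_coe, iInf_domain_formRoots hW hW₀]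
  exact testVec_mem_freeFormDomain hW hf hc

theorem exists_invSqrt_freeForm (hc : ∀ j, 0 < c j) (hW : LocallyIntegrable W volume)
    (hW₀ : ∀ᵐ X, 0 ≤ W X) :
    ∃ (R Y : ParticleSpace N d →L[ℂ] ParticleSpace N d)
      (D : Fin N → Fin d → ParticleSpace N d →L[ℂ] ParticleSpace N d),
      R.IsPositive ∧ Set.range R = freeFormDomain W ∧
      (∀ φ, freeFormOf c W (R φ) + ‖R φ‖ ^ 2 = ‖φ‖ ^ 2) ∧
      (∀ φ, ∫ X, W X * ‖R φ X‖ ^ 2 = ‖Y φ‖ ^ 2) ∧ ∀ j l φ, weakPartial (R φ) j l = D j l φ := by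
  have domain_eq := iInf_domain_formRoots (c := c) hW hW₀
  obtain ⟨R, S, positive, range_eq, graph, norm_sq⟩ := exists_isPositive_range_eq_iInf_domain
    (isClosed_formRoots hc) (domain_eq ▸ dense_freeFormDomain hW hW₀)
  have potential : ∀ φ, ∫ X, W X * ‖R φ X‖ ^ 2 = ‖S none φ‖ ^ 2 := fun φ => by
    rw [Lp_norm_sq_eq_integral, integral_congr_ae (norm_sq_ae_eq_of_ae_eq_sqrt_smul hW₀
      (mem_graph_mulPMap.1 (graph none φ)))]
  have sqrt_ne_zero : ∀ j, (√(c j) : ℂ) ≠ 0 := fun j =>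
    Complex.ofReal_ne_zero.2 (Real.sqrt_ne_zero'.2 (hc j))
  have derivative : ∀ j l φ, weakPartial (R φ) j l = (√(c j) : ℂ)⁻¹ • S (some (j, l)) φ :=
    fun j l φ => HasWeakPartial.weakPartial_eq <| mem_graph_weakPartialPMap.1 <|
      (mem_graph_smul_linearPMap (sqrt_ne_zero j)).1 (graph (some (j, l)) φ)
  have kinetic : ∀ j l φ, c j * ‖weakPartial (R φ) j l‖ ^ 2 = ‖S (some (j, l)) φ‖ ^ 2 := by
    intro j l φ
    rw [derivative, ← norm_sq_sqrt_smul (hc j).le, smul_inv_smul₀ (sqrt_ne_zero j)]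
  refine ⟨R, S none, fun j l => (√(c j) : ℂ)⁻¹ • S (some (j, l)), positive,
    range_eq.trans domain_eq, fun φ => ?_, potential, derivative⟩
  simp only [freeFormOf, potential, Finset.mul_sum, kinetic]
  rw [← norm_sq φ, Fintype.sum_option, Fintype.sum_prod_type]
  ring

end FormDomain

/-! ## Bounded quadratic forms -/

section BoundedForms

variable {H K : Type*} [NormedAddCommGroup H] [InnerProductSpace ℂ H] [NormedAddCommGroup K]
  [InnerProductSpace ℂ K]

/-- `q` is the quadratic form `φ ↦ ⟨φ|G φ⟩` of a bounded operator `G`. -/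
def IsBoundedForm (q : H → ℝ) : Prop :=
  ∃ G : H →L[ℂ] H, ∀ φ, inner ℂ φ (G φ) = ((q φ : ℝ) : ℂ)

namespace IsBoundedForm

variable {p q : H → ℝ}

theorem add (hp : IsBoundedForm p) (hq : IsBoundedForm q) :
    IsBoundedForm fun φ => p φ + q φ := by
  obtain ⟨A, hA⟩ := hp
  obtain ⟨B, hB⟩ := hq
  exact ⟨A + B, fun φ => by rw [add_apply, inner_add_right, hA, hB, Complex.ofReal_add]⟩

theorem const_mul (a : ℝ) (hq : IsBoundedForm q) : IsBoundedForm fun φ => a * q φ := by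
  obtain ⟨A, hA⟩ := hq
  exact ⟨(a : ℂ) • A, fun φ => by rw [smul_apply, inner_smul_right, hA, Complex.ofReal_mul]⟩

theorem sub (hp : IsBoundedForm p) (hq : IsBoundedForm q) :
    IsBoundedForm fun φ => p φ - q φ := by
  simpa only [neg_one_mul, ← sub_eq_add_neg] using hp.add (hq.const_mul (-1))

theorem sum {ι : Type*} [Fintype ι] {q : ι → H → ℝ} (hq : ∀ i, IsBoundedForm (q i)) :
    IsBoundedForm fun φ => ∑ i, q i φ := by
  choose A hA using hq
  exact ⟨∑ i, A i, fun φ => by simp only [sum_apply, inner_sum, hA, Complex.ofReal_sum]⟩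

variable [CompleteSpace H] [CompleteSpace K]

theorem re_inner (A B : H →L[ℂ] K) : IsBoundedForm fun φ => (inner ℂ (A φ) (B φ)).re := by
  refine ⟨(2⁻¹ : ℂ) • (A.adjoint ∘L B + B.adjoint ∘L A), fun φ => ?_⟩
  rw [smul_apply, inner_smul_right, add_apply, inner_add_right, ContinuousLinearMap.comp_apply,
    ContinuousLinearMap.comp_apply, ContinuousLinearMap.adjoint_inner_right,
    ContinuousLinearMap.adjoint_inner_right, ← inner_conj_symm (B φ) (A φ), Complex.add_conj]
  push_cast
  ring

theorem norm_sq (A : H →L[ℂ] K) : IsBoundedForm fun φ => ‖A φ‖ ^ 2 := by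
  simpa only [← RCLike.re_to_complex, inner_self_eq_norm_sq] using re_inner A A

end IsBoundedForm

section BoundedMultiplication

variable {α : Type*} [MeasurableSpace α] {μ : Measure α} {f : α → ℝ}

/-- Multiplication by an essentially bounded real function, as a bounded operator on `L²`. -/
noncomputable def boundedMul (hf : MemLp f ⊤ μ) : Lp ℂ 2 μ →L[ℂ] Lp ℂ 2 μ :=
  (ContinuousLinearMap.mul ℂ ℂ).holderL μ ⊤ 2 2 (hf.ofReal (K := ℂ)).toLp

theorem coeFn_boundedMul (hf : MemLp f ⊤ μ) (ψ : Lp ℂ 2 μ) :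
    boundedMul hf ψ =ᵐ[μ] fun x => (f x : ℂ) * ψ x := by
  filter_upwards [(ContinuousLinearMap.mul ℂ ℂ).coeFn_holder (r := 2) (hf.ofReal (K := ℂ)).toLp ψ,
    (hf.ofReal (K := ℂ)).coeFn_toLp] with x apply_holder apply_toLp
  exact apply_holder.trans (by rw [apply_toLp]; rfl)

theorem re_inner_boundedMul (hf : MemLp f ⊤ μ) (ψ g : Lp ℂ 2 μ) :
    (inner ℂ ψ (boundedMul hf g)).re = ∫ x, f x * (conj (ψ x) * g x).re ∂μ := by
  rw [L2.inner_def]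
  refine (integral_re (L2.integrable_inner (𝕜 := ℂ) ψ (boundedMul hf g))).symm.trans
    (integral_congr_ae ?_)
  filter_upwards [coeFn_boundedMul hf g] with x hx
  rw [hx, RCLike.inner_apply, RCLike.re_to_complex, ← Complex.re_ofReal_mul]
  congr 1
  ring

variable {H : Type*} [NormedAddCommGroup H] [InnerProductSpace ℂ H] [CompleteSpace H]

theorem isBoundedForm_integral_mul_re_conj_mul (hf : MemLp f ⊤ μ) (A B : H →L[ℂ] Lp ℂ 2 μ) :
    IsBoundedForm fun φ => ∫ x, f x * (conj (A φ x) * B φ x).re ∂μ := by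
  simpa only [ContinuousLinearMap.comp_apply, re_inner_boundedMul]
    using IsBoundedForm.re_inner A (boundedMul hf ∘L B)

theorem isBoundedForm_integral_mul_norm_sq (hf : MemLp f ⊤ μ) (A : H →L[ℂ] Lp ℂ 2 μ) :
    IsBoundedForm fun φ => ∫ x, f x * ‖A φ x‖ ^ 2 ∂μ := by
  simpa only [← Complex.normSq_eq_conj_mul_self, Complex.ofReal_re, Complex.normSq_eq_norm_sq]
    using isBoundedForm_integral_mul_re_conj_mul hf A A

theorem isBoundedForm_integral_norm_mul_add_mul_sq (hf : MemLp f ⊤ μ) (a : ℂ)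
    (A B : H →L[ℂ] Lp ℂ 2 μ) :
    IsBoundedForm fun φ => ∫ x, ‖a * A φ x + (f x : ℂ) * B φ x‖ ^ 2 ∂μ := by
  convert IsBoundedForm.norm_sq (a • A + boundedMul hf ∘L B) using 2 with φ
  rw [Lp_norm_sq_eq_integral]
  refine integral_congr_ae ?_
  filter_upwards [Lp.coeFn_add (a • A φ) (boundedMul hf (B φ)), Lp.coeFn_smul a (A φ),
    coeFn_boundedMul hf (B φ)] with x h_add h_smul h_mul
  rw [add_apply, smul_apply, ContinuousLinearMap.comp_apply, h_add, Pi.add_apply, h_smul, h_mul,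
    Pi.smul_apply, smul_eq_mul]

end BoundedMultiplication

end BoundedForms

section BoundedFunctions

theorem memLp_top_comp {α β E : Type*} [MeasurableSpace α] [MeasurableSpace β]
    [NormedAddCommGroup E] {μ : Measure α} {ν : Measure β} {f : β → E} {g : α → β}
    (hf : MemLp f ⊤ ν) (hg : Measure.QuasiMeasurePreserving g μ ν) : MemLp (f ∘ g) ⊤ μ := by
  refine MemLp.comp_of_map ⟨hf.1.mono_ac hg.absolutelyContinuous, ?_⟩ hg.aemeasurable
  rw [eLpNorm_exponent_top]
  exact (eLpNormEssSup_mono_measure f hg.absolutelyContinuous).trans_lt hf.eLpNorm_lt_top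

theorem memLp_top_comp_particle {N d : ℕ} {f : EuclideanSpace ℝ (Fin d) → ℝ}
    (hf : MemLp f ⊤ volume) (j : Fin N) : MemLp (fun X : Config N d => f (X j)) ⊤ volume :=
  memLp_top_comp hf (Measure.quasiMeasurePreserving_eval _ j)

theorem memLp_top_two_mul_re_inner {α E : Type*} [MeasurableSpace α]
    [NormedAddCommGroup E] [InnerProductSpace ℂ E] {μ : Measure α} {f : α → E}
    (hf : MemLp f ⊤ μ) (a : E) : MemLp (fun x => 2 * (inner ℂ a (f x)).re) ⊤ μ :=
  (hf.const_inner (𝕜 := ℂ) a).re.const_mul 2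

theorem memLp_top_fourierIntegral {V : Type*} [NormedAddCommGroup V] [InnerProductSpace ℝ V]
    [SecondCountableTopology V] [MeasurableSpace V] [BorelSpace V] {μ ν : Measure V} [SFinite ν]
    {f : V → ℂ} (hf : StronglyMeasurable f) :
    MemLp (fun x => ∫ k, f k * Complex.exp (-Complex.I * ((inner ℝ k x : ℝ) : ℂ)) ∂ν) ⊤ μ := by
  have measurable : StronglyMeasurable fun x =>
      ∫ k, f k * Complex.exp (-Complex.I * ((inner ℝ k x : ℝ) : ℂ)) ∂ν := by
    refine StronglyMeasurable.integral_prod_right' (ν := ν)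
      (f := fun p : V × V => f p.2 * Complex.exp (-Complex.I * ((inner ℝ p.2 p.1 : ℝ) : ℂ))) ?_
    exact (hf.comp_measurable measurable_snd).mul (Continuous.stronglyMeasurable (by fun_prop))
  have norm_exp : ∀ k x : V, ‖Complex.exp (-Complex.I * ((inner ℝ k x : ℝ) : ℂ))‖ = 1 := by
    intro k x
    rw [neg_mul, ← mul_neg, ← Complex.ofReal_neg, Complex.norm_exp_I_mul_ofReal]
  refine memLp_top_of_bound measurable.aestronglyMeasurable (∫ k, ‖f k‖ ∂ν)
    (ae_of_all _ fun x => ?_)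
  refine (norm_integral_le_integral_norm _).trans_eq ?_
  simp only [norm_mul, norm_exp, mul_one]

variable {d : ℕ} (r : ℝ) (z : PolaronField d)

theorem memLp_top_polaronLow : MemLp (polaronLow r z) ⊤ volume := by
  have measurable : StronglyMeasurable fun k =>
      conj (z k) * ((‖k‖ ^ (-((d : ℝ) - 1) / 2) : ℝ) : ℂ) :=
    (Complex.continuous_conj.comp_stronglyMeasurable (Lp.stronglyMeasurable z)).mul
      (Measurable.stronglyMeasurable (by fun_prop))
  refine ((memLp_top_fourierIntegral (ν := volume.restrict
    {k : EuclideanSpace ℝ (Fin d) | ‖k‖ ≤ r}) measurable).re.const_mul 2).ae_eq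
    (ae_of_all _ fun x => ?_)
  simp only [polaronLow, mul_right_comm (conj (z _)) (Complex.exp _)]
  rfl

theorem memLp_top_polaronHigh (l : Fin d) : MemLp (polaronHigh r z l) ⊤ volume := by
  have measurable : StronglyMeasurable fun k =>
      conj (z k) * ((‖k‖ ^ (-((d : ℝ) + 1) / 2) * (k l / ‖k‖) : ℝ) : ℂ) :=
    (Complex.continuous_conj.comp_stronglyMeasurable (Lp.stronglyMeasurable z)).mul
      (Measurable.stronglyMeasurable (by fun_prop))
  refine ((memLp_top_fourierIntegral (ν := volume.restrict
    {k : EuclideanSpace ℝ (Fin d) | r < ‖k‖}) measurable).im.const_mul (-2)).ae_eq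
    (ae_of_all _ fun x => ?_)
  simp only [polaronHigh, mul_right_comm (conj (z _)) (Complex.exp _)]
  rfl

end BoundedFunctions

/-! ## The three models -/

instance {h : Type*} [NormedAddCommGroup h] [InnerProductSpace ℂ h] [CompleteSpace h]
    (ω : Dispersion h) : BorelSpace ω.PhaseSpace := ⟨rfl⟩

instance (d : ℕ) : BorelSpace (PolaronField d) := ⟨rfl⟩

section Models

variable {h : Type*} [NormedAddCommGroup h] [InnerProductSpace ℂ h] [CompleteSpace h]
  {ω : Dispersion h} {N d : ℕ}

theorem isBoundedForm_freeFormOf {c : Fin N → ℝ} {W : Config N d → ℝ}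
    {R Y : ParticleSpace N d →L[ℂ] ParticleSpace N d}
    {D : Fin N → Fin d → ParticleSpace N d →L[ℂ] ParticleSpace N d}
    (potential : ∀ φ, ∫ X, W X * ‖R φ X‖ ^ 2 = ‖Y φ‖ ^ 2)
    (derivative : ∀ j l φ, weakPartial (R φ) j l = D j l φ) :
    IsBoundedForm fun φ => freeFormOf c W (R φ) := by
  simp only [freeFormOf, potential, derivative]
  exact (IsBoundedForm.sum fun j => (IsBoundedForm.sum fun l =>
    IsBoundedForm.norm_sq (D j l)).const_mul (c j)).add (IsBoundedForm.norm_sq Y)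

theorem isFormBounded_nelsonModel {W : Config N d → ℝ} (hW : LocallyIntegrable W volume)
    (hW₀ : ∀ᵐ X, 0 ≤ W X) (F : NelsonFormFactor ω d) : (nelsonModel W F).IsFormBounded := by
  obtain ⟨R, Y, D, positive, range_eq, norm_sq, potential, derivative⟩ :=
    exists_invSqrt_freeForm (c := fun _ : Fin N => 1) (fun _ => one_pos) hW hW₀
  have coupling : ∀ z, IsBoundedForm fun φ =>
      ∑ j, ∫ X, nelsonPotential F z (X j) * ‖R φ X‖ ^ 2 := fun z =>
    IsBoundedForm.sum fun j => isBoundedForm_integral_mul_norm_sq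
      (memLp_top_comp_particle (memLp_top_two_mul_re_inner F.memLp_xi _) j) R
  exact ⟨R, ⟨positive, range_eq, norm_sq⟩, fun z =>
    ((isBoundedForm_freeFormOf potential derivative).add (coupling z)).add
      ((IsBoundedForm.norm_sq R).const_mul _)⟩

theorem isFormBounded_polaronModel {W : Config N d → ℝ} (hW : LocallyIntegrable W volume)
    (hW₀ : ∀ᵐ X, 0 ≤ W X) (α r : ℝ) : (polaronModel W α r).IsFormBounded := by
  obtain ⟨R, Y, D, positive, range_eq, norm_sq, potential, derivative⟩ :=
    exists_invSqrt_freeForm (c := fun _ : Fin N => 1) (fun _ => one_pos) hW hW₀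
  have low : ∀ z j, IsBoundedForm fun φ => ∫ X, polaronLow r z (X j) * ‖R φ X‖ ^ 2 := fun z j =>
    isBoundedForm_integral_mul_norm_sq (memLp_top_comp_particle (memLp_top_polaronLow r z) j) R
  have high : ∀ z j l, IsBoundedForm fun φ =>
      ∫ X, polaronHigh r z l (X j) * (conj (R φ X) * weakPartial (R φ) j l X).re := by
    intro z j l
    simp only [derivative]
    exact isBoundedForm_integral_mul_re_conj_mul
      (memLp_top_comp_particle (memLp_top_polaronHigh r z l) j) R (D j l)
  have coupling := fun z => IsBoundedForm.sum fun j =>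
    (low z j).sub ((IsBoundedForm.sum (high z j)).const_mul 2)
  exact ⟨R, ⟨positive, range_eq, norm_sq⟩, fun z =>
    ((isBoundedForm_freeFormOf potential derivative).add ((coupling z).const_mul (√α))).add
      ((IsBoundedForm.norm_sq R).const_mul _)⟩

theorem isFormBounded_pauliFierzModel {W : Config N 3 → ℝ} (hW : LocallyIntegrable W volume)
    (hW₀ : ∀ᵐ X, 0 ≤ W X) {mass : Fin N → ℝ} (hmass : ∀ j, 0 < mass j) (e : ℝ)
    (F : PauliFierzFormFactor ω N) : (pauliFierzModel W mass e F).IsFormBounded := by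
  obtain ⟨R, Y, D, positive, range_eq, norm_sq, potential, derivative⟩ := exists_invSqrt_freeForm
    (c := fun j => 1 / (2 * mass j)) (fun j => one_div_pos.2 (mul_pos two_pos (hmass j))) hW hW₀
  have magnetic : ∀ z j l, IsBoundedForm fun φ => ∫ X, ‖-Complex.I * weakPartial (R φ) j l X
      + ((e * pauliFierzField F z j l (X j) : ℝ) : ℂ) * R φ X‖ ^ 2 := by
    intro z j l
    simp only [derivative]
    exact isBoundedForm_integral_norm_mul_add_mul_sq ((memLp_top_comp_particle
      (memLp_top_two_mul_re_inner (F.memLp_xi j l) (ω.sqrtExt z)) j).const_mul e) _ (D j l) R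
  have trap : IsBoundedForm fun φ => ∫ X, W X * ‖R φ X‖ ^ 2 := by
    simpa only [potential] using IsBoundedForm.norm_sq Y
  exact ⟨R, ⟨positive, range_eq, norm_sq⟩, fun z => ((IsBoundedForm.sum fun j =>
    (IsBoundedForm.sum (magnetic z j)).const_mul (1 / (2 * mass j))).add trap).add
      ((IsBoundedForm.norm_sq R).const_mul _)⟩

end Models

theorem mainTheorem11_general {h : Type*} [NormedAddCommGroup h] [InnerProductSpace ℂ h]
    [CompleteSpace h] (ω : Dispersion h) (N : ℕ) :
    (∀ (d : ℕ) (W : Config N d → ℝ), LocallyIntegrable W volume → (∀ᵐ X, 0 ≤ W X) →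
      ∀ (F : NelsonFormFactor ω d),
      (nelsonModel W F).energyQC = (nelsonModel W F).energyGQC ∧
      (nelsonModel W F).energyGQC = (nelsonModel W F).energyGSVM ∧
      (nelsonModel W F).energyGQCPure = (nelsonModel W F).energyQC) ∧
    (∀ (d : ℕ) (W : Config N d → ℝ), LocallyIntegrable W volume → (∀ᵐ X, 0 ≤ W X) →
      ∀ (α r : ℝ), 0 < α → 0 < r →
      (polaronModel W α r).energyQC = (polaronModel W α r).energyGQC ∧
      (polaronModel W α r).energyGQC = (polaronModel W α r).energyGSVM ∧
      (polaronModel W α r).energyGQCPure = (polaronModel W α r).energyQC) ∧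
    (∀ (W : Config N 3 → ℝ), LocallyIntegrable W volume → (∀ᵐ X, 0 ≤ W X) →
      ∀ (mass : Fin N → ℝ) (e : ℝ) (F : PauliFierzFormFactor ω N), (∀ j, 0 < mass j) →
      (pauliFierzModel W mass e F).energyQC = (pauliFierzModel W mass e F).energyGQC ∧
      (pauliFierzModel W mass e F).energyGQC = (pauliFierzModel W mass e F).energyGSVM ∧
      (pauliFierzModel W mass e F).energyGQCPure = (pauliFierzModel W mass e F).energyQC) :=
  ⟨fun _ _ hW hW₀ F => QuasiClassicalForms.energies_eq (isFormBounded_nelsonModel hW hW₀ F),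
    fun _ _ hW hW₀ α r _ _ =>
      QuasiClassicalForms.energies_eq (isFormBounded_polaronModel hW hW₀ α r),
    fun _ hW hW₀ _ e F hmass =>
      QuasiClassicalForms.energies_eq (isFormBounded_pauliFierzModel hW hW₀ hmass e F)⟩

theorem mainTheorem11 {h : Type*} [NormedAddCommGroup h] [InnerProductSpace ℂ h]
    [CompleteSpace h] (ω : Dispersion h) (N : ℕ) :
    -- Nelson model
    (∀ (d : ℕ), d = 1 ∨ d = 2 ∨ d = 3 → ∀ (W : Config N d → ℝ), LocallyIntegrable W volume →
      (∀ᵐ X, 0 ≤ W X) → ∀ (F : NelsonFormFactor ω d),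
      (nelsonModel W F).energyQC = (nelsonModel W F).energyGQC ∧
      (nelsonModel W F).energyGQC = (nelsonModel W F).energyGSVM ∧
      (nelsonModel W F).energyGQCPure = (nelsonModel W F).energyQC) ∧
    -- polaron
    (∀ (d : ℕ), d = 1 ∨ d = 2 ∨ d = 3 → ∀ (W : Config N d → ℝ), LocallyIntegrable W volume →
      (∀ᵐ X, 0 ≤ W X) → ∀ (α r : ℝ), 0 < α → 0 < r →
      (polaronModel W α r).energyQC = (polaronModel W α r).energyGQC ∧
      (polaronModel W α r).energyGQC = (polaronModel W α r).energyGSVM ∧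
      (polaronModel W α r).energyGQCPure = (polaronModel W α r).energyQC) ∧
    -- Pauli-Fierz model
    (∀ (W : Config N 3 → ℝ), LocallyIntegrable W volume → (∀ᵐ X, 0 ≤ W X) →
      ∀ (mass : Fin N → ℝ) (e : ℝ) (F : PauliFierzFormFactor ω N), (∀ j, 0 < mass j) →
      (pauliFierzModel W mass e F).energyQC = (pauliFierzModel W mass e F).energyGQC ∧
      (pauliFierzModel W mass e F).energyGQC = (pauliFierzModel W mass e F).energyGSVM ∧
      (pauliFierzModel W mass e F).energyGQCPure = (pauliFierzModel W mass e F).energyQC) := by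
  obtain ⟨nelson, polaron, pauliFierz⟩ := mainTheorem11_general ω N
  exact ⟨fun d _ => nelson d, fun d _ => polaron d, pauliFierz⟩
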